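/- Let $b\ge 1$, $m=2^b$, and let $\mathcal S_m$ be the set of $m\times m$ density matrices (positive semidefinite Hermitian complex matrices of trace $1$); for $1\le r\le m$ let $\mathcal S_{r,m}=\{S\in\mathcal S_m:\operatorname{rank}(S)\le r\}$. The Pauli basis $\{E_1,\dots,E_{m^2}\}$ consists of the $4^b$ matrices $W_{i_1}\otimes\cdots\otimes W_{i_b}$, where $W_i=\sigma_i/\sqrt2$ and $$\sigma_1=\begin{pmatrix}1&0\\0&1\end{pmatrix},\quad \sigma_2=\begin{pmatrix}0&-i\\i&0\end{pmatrix},\quad \sigma_3=\begin{pmatrix}0&1\\1&0\end{pmatrix},\quad \sigma_4=\begin{pmatrix}1&0\\0&-1\end{pmatrix}.$$ Let $n\ge 1$. For $\rho\in\mathcal S_m$ let $\mathbb P_\rho$ be the distribution of $n$ i.i.d. pairs $(X_1,Y_1),\dots,(X_n,Y_n)$, where $X_j$ is uniformly distributed in the Pauli basis and, given $X_j$, $Y_j$ is the outcome of a measurement of the observable $X_j$ in the state $\rho$: each eigenvalue $\lambda$ of $X_j$ (these lie in $\{\pm 1/\sqrt m\}$) is obtained with probability $\operatorname{tr}(\rho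 P_\lambda)$, $P_\lambda$ being the corresponding eigenprojector. Write $\|A\|_q=(\sum_j|\lambda_j(A)|^q)^{1/q}$ for the Schatten $q$-norm of a Hermitian matrix with eigenvalues $\lambda_j(A)$ ($\|A\|_\infty=\max_j|\lambda_j(A)|$, and $1/q=0$ for $q=\infty$), $H^2(S_1,S_2)=2-2\operatorname{tr}\sqrt{S_1^{1/2}S_2S_1^{1/2}}$ for the squared Hellinger (Bures) distance, and $K(S_1\|S_2)=\operatorname{tr}\big(S_1(\log S_1-\log S_2)\big)$ for the Kullback--Leibler divergence (with $0\log 0=0$, and $K(S_1\|S_2)=+\infty$ if $S_2$ is singular). **Theorem.** For every $q\in[1,+\infty]$ there exist constants $c,c'>0$, depending only on $q$, such that for all $b\ge1$, $m=2^b$, $n\ge1$ and $1\le r\le m$, $$\inf_{\hat\rho}\ \sup_{\rho\in\mathcal S_{r,m}}\mathbb P_\rho\Big\{\|\hat\rho-\rho\|_q\ge c\Big(\frac{m\,r^{1/q}}{\sqrt n}\wedge\Big(\frac{m}{\sqrt n}\Big)^{1-\frac1q}\wedge 1\Big)\Big\}\ge c',$$ and, if moreover $r\ge 2$, $$\inf_{\hat\rho}\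 \sup_{\rho\in\mathcal S_{r,m}}\mathbb P_\rho\Big\{H^2(\hat\rho,\rho)\ge c\Big(\frac{m\,r}{\sqrt n}\wedge1\Big)\Big\}\ge c',$$ $$\inf_{\hat\rho}\ \sup_{\rho\in\mathcal S_{r,m}}\mathbb P_\rho\Big\{K(\rho\|\hat\rho)\ge c\Big(\frac{m\,r}{\sqrt n}\wedge1\Big)\Big\}\ge c'.$$ Here $\inf_{\hat\rho}$ is the infimum over all estimators $\hat\rho$ with values in $\mathcal S_m$ based on the data $(X_1,Y_1),\dots,(X_n,Y_n)$, that is, over all measurable maps from the data to $\mathcal S_m$. -/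

import Mathlib

open MeasureTheory Matrix
open scoped ENNReal ComplexOrder

noncomputable section

namespace QuantumTomography

/-- The product (equivalently, Borel) σ-algebra on a space of matrices. -/
instance matrixMeasurableSpace {m n α : Type*} [MeasurableSpace α] :
    MeasurableSpace (Matrix m n α) :=
  inferInstanceAs (MeasurableSpace (m → n → α))

/-! ### Density matrices -/

/-- Density matrices: positive semidefinite Hermitian matrices of unit trace. -/
abbrev DensityMatrix (ι : Type*) [Fintype ι] : Type _ :=
  {S : Matrix ι ι ℂ // S.PosSemidef ∧ S.trace = 1}

/-- The class of density matrices of rank at most `r`. -/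
def lowRankStates (ι : Type*) [Fintype ι] (r : ℕ) : Set (DensityMatrix ι) :=
  {S | S.1.rank ≤ r}

/-! ### Distances -/

/-- The Schatten `q`-norm of a Hermitian matrix: the `ℓ^q`-norm of its eigenvalues (counted with
multiplicity), that is `(∑ |λⱼ|^q)^(1/q)` for `1 ≤ q < ∞` and `max |λⱼ|` for `q = ∞`. -/
def schattenNorm {ι : Type*} [Fintype ι] [DecidableEq ι] (q : ℝ≥0∞) {A : Matrix ι ι ℂ}
    (hA : A.IsHermitian) : ℝ :=
  ‖WithLp.toLp q hA.eigenvalues‖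

/-- The Schatten `q`-norm distance `‖S₁ - S₂‖_q`. -/
def schattenDist {ι : Type*} [Fintype ι] [DecidableEq ι] (q : ℝ≥0∞)
    (S₁ S₂ : DensityMatrix ι) : ℝ :=
  schattenNorm q (S₁.2.1.isHermitian.sub S₂.2.1.isHermitian : (S₁.1 - S₂.1).IsHermitian)

/-- The squared Hellinger (Bures) distance `H²(S₁, S₂) = 2 - 2 tr √(S₁^{1/2} S₂ S₁^{1/2})`;
square roots of positive semidefinite matrices are taken in the functional calculus. -/
def buresSq {ι : Type*} [Fintype ι] [DecidableEq ι] (S₁ S₂ : DensityMatrix ι) : ℝ :=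
  2 - 2 * (cfc Real.sqrt (cfc Real.sqrt S₁.1 * S₂.1 * cfc Real.sqrt S₁.1)).trace.re

open Classical in
/-- The noncommutative Kullback–Leibler divergence `K(S₁‖S₂) = ⟨S₁, log S₁ - log S₂⟩`, equal to
`+∞` when `S₂` is singular. The value `Real.log 0 = 0` on the kernel of `S₁` is the convention
`0 log 0 = 0`. -/
def klDivergence {ι : Type*} [Fintype ι] [DecidableEq ι] (S₁ S₂ : DensityMatrix ι) : EReal :=
  if S₂.1.PosDef then (((S₁.1 * (cfc Real.log S₁.1 - cfc Real.log S₂.1)).trace.re : ℝ) : EReal)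
  else ⊤

/-! ### Measurements -/

/-- The eigenprojector of the Hermitian matrix `A` for the eigenvalue `t`: the function that is
`1` at `t` and `0` elsewhere, applied to `A`. -/
def eigenprojector {ι : Type*} [Fintype ι] [DecidableEq ι] (A : Matrix ι ι ℂ) (t : ℝ) :
    Matrix ι ι ℂ :=
  cfc (Pi.single t (1 : ℝ) : ℝ → ℝ) A

/-- The distribution of the outcome of a measurement of the observable `A` for a system prepared
in state `ρ`: the eigenvalue `t` of `A`, with eigenprojector `P`, occurs with probability
`tr (ρ P)`. -/
def measurementLaw {ι : Type*} [Fintype ι] [DecidableEq ι] (ρ : DensityMatrix ι)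
    (A : Matrix ι ι ℂ) : Measure ℝ :=
  Measure.sum fun t : spectrum ℝ A =>
    ENNReal.ofReal (ρ.1 * eigenprojector A t).trace.re • Measure.dirac (t : ℝ)

/-! ### The Pauli basis -/

/-- The four matrices `σ₁ = I, σ₂, σ₃, σ₄`. -/
def pauliMatrix : Fin 4 → Matrix (Fin 2) (Fin 2) ℂ :=
  ![!![1, 0; 0, 1], !![0, -Complex.I; Complex.I, 0], !![0, 1; 1, 0], !![1, 0; 0, -1]]

/-- The index set of the standard basis of `(ℂ²)^{⊗ b}`; it has `2 ^ b` elements. -/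
abbrev Qubits (b : ℕ) : Type := Fin b → Fin 2

/-- The element `W_{k 1} ⊗ ⋯ ⊗ W_{k b}` of the Pauli basis for `b` qubits, `W_i = σ_i / √2`. -/
def pauliBasis (b : ℕ) (k : Fin b → Fin 4) : Matrix (Qubits b) (Qubits b) ℂ :=
  Matrix.of fun i j => ∏ l, ((((Real.sqrt 2)⁻¹ : ℝ) : ℂ) • pauliMatrix (k l)) (i l) (j l)

/-! ### The statistical model -/

/-- A single observation `(X, Y)`. -/
abbrev Observation (b : ℕ) : Type := Matrix (Qubits b) (Qubits b) ℂ × ℝ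

/-- The distribution of `(X, Y)`: `X` is uniform in the Pauli basis (`4 ^ b` elements) and, given
`X`, `Y` is the outcome of a measurement of `X` for the system prepared in state `ρ`. -/
def observationLaw {b : ℕ} (ρ : DensityMatrix (Qubits b)) : Measure (Observation b) :=
  ∑ k : Fin b → Fin 4, ((4 : ℝ≥0∞) ^ b)⁻¹ •
    (Measure.dirac (pauliBasis b k)).prod (measurementLaw ρ (pauliBasis b k))

/-- The distribution `ℙ_ρ` of the data `(X₁, Y₁), …, (Xₙ, Yₙ)`: `n` i.i.d. copies of `(X, Y)`. -/
def dataLaw {b : ℕ} (n : ℕ) (ρ : DensityMatrix (Qubits b)) : Measure (Fin n → Observation b) :=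
  Measure.pi fun _ => observationLaw ρ

/-- Estimators with values in the density matrices: measurable functions of the data. -/
abbrev Estimator (b n : ℕ) : Type :=
  {f : (Fin n → Observation b) → DensityMatrix (Qubits b) // Measurable f}

/-- The minimax probability `inf_{ρ̂} sup_{ρ ∈ 𝒮_{r,m}} ℙ_ρ {Bad ρ̂ ρ}`, `m = 2 ^ b`, for a relation
`Bad` between the estimate and the target (such as `‖ρ̂ - ρ‖_q ≥ s`). -/
def minimaxProb (b n r : ℕ)
    (Bad : DensityMatrix (Qubits b) → DensityMatrix (Qubits b) → Prop) : ℝ≥0∞ :=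
  ⨅ f : Estimator b n, ⨆ ρ ∈ lowRankStates (Qubits b) r, dataLaw n ρ {d | Bad (f.1 d) ρ}

end QuantumTomography

end

/-!
The minimax risk over states of rank at most `r` is bounded below by testing a large finite family
of states against one reference state.

*Information.* Only finitely many values of an observation have positive probability, and the
`χ²`-divergence of one observation in the state `ρ` from one in the state `τ` is, by Parseval's
identity for the Pauli basis, at most `2 ‖ρ - τ‖₂² / m`, provided that the nontrivial Pauli
coefficients `√m tr (τ E_k)` are bounded away from `± 1` (`sum_outcomeProb_sq_div_le`). This fails
for stabilizer states, but holds for the tensor power of a one-qubit pure state all of whose Bloch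
coordinates are less than `1`; this is the reference state `ρ₀ = ψ ψ*`, and mixing it with the
identity keeps the property. The `χ²`-divergence tensorizes, so by the Cauchy–Schwarz inequality a
family of `N` states with `n · 2 ‖ρ_j - τ‖₂² / m ≤ log N / 2`, no two of which are well approximated
by the same state, forces every estimator to fail with constant probability (`minimaxProb_ge`). The
number `N = 2` is allowed, which settles small dimensions.

*Families.* For `r = 1` the states are the pure states of `√(1 - δ²) ψ + δ v`, where `v` runs
through an exponentially large sign code orthogonal to `ψ`. For `r ≥ 2` they are the mixtures
`(1 - ε) ρ₀ + ε P / s`, where `P` runs through `exp (m s / 16)` projections of rank `s < r` with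
range orthogonal to `ψ` and Hilbert–Schmidt distances of order `√s` (`exists_projection_packing`).
Such projections are found explicitly: the projection onto the graph of a matrix `T` has lower left
block `T (1 + T* T)⁻¹`, which is close to `T` when `T* T` is small (`hsSq_sub_mul_graphInv_le`). With
`T` a small multiple of a sign matrix, the error is controlled by the fourth moment
`tr ((T* T)²)`, which is of the right size for at least half of the sign matrices, and the
Gilbert–Varshamov bound provides enough of these that differ in many entries.

*Distances.* No triangle inequality is needed. For Schatten norms, the trace of `ρ_j - ρ_k` against
a difference of two projections is bounded by Hölder's inequality in an eigenbasis
(`re_trace_mul_sub_le_schattenNorm`). The Bures distance and the Kullback–Leibler divergence both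
dominate the Hellinger distance of the outcomes of any two-valued measurement
(`sq_sqrt_sub_sqrt_le_buresSq`, `sq_sqrt_sub_sqrt_le_klDivergence`), and measuring `P_j` separates
`(1 - ε) ρ₀ + ε P_j / s` from `(1 - ε) ρ₀ + ε P_k / s` by a constant times `ε`.
-/

noncomputable section

namespace QuantumTomography

/-! ### Tensor products of one-qubit matrices and the Pauli basis -/

/-- The tensor product `M 1 ⊗ ⋯ ⊗ M b` of one-qubit matrices, in the standard basis. -/
def qubitTensor {b : ℕ} (M : Fin b → Matrix (Fin 2) (Fin 2) ℂ) : Matrix (Qubits b) (Qubits b) ℂ :=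
  Matrix.of fun i j => ∏ l, M l (i l) (j l)

theorem qubitTensor_mul {b : ℕ} (M N : Fin b → Matrix (Fin 2) (Fin 2) ℂ) :
    qubitTensor M * qubitTensor N = qubitTensor fun l => M l * N l := by
  ext i j
  simp only [qubitTensor, mul_apply, of_apply, ← Finset.prod_mul_distrib]
  rw [Finset.prod_univ_sum, Fintype.piFinset_univ]

theorem trace_qubitTensor {b : ℕ} (M : Fin b → Matrix (Fin 2) (Fin 2) ℂ) :
    (qubitTensor M).trace = ∏ l, (M l).trace := by
  simp only [qubitTensor, trace, diag_apply, of_apply]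
  rw [Finset.prod_univ_sum, Fintype.piFinset_univ]

theorem conjTranspose_qubitTensor {b : ℕ} (M : Fin b → Matrix (Fin 2) (Fin 2) ℂ) :
    (qubitTensor M)ᴴ = qubitTensor fun l => (M l)ᴴ := by
  ext i j
  simp [qubitTensor, conjTranspose_apply]

theorem qubitTensor_smul_one {b : ℕ} (c : ℂ) :
    qubitTensor (fun _ : Fin b => c • (1 : Matrix (Fin 2) (Fin 2) ℂ)) =
      c ^ b • (1 : Matrix (Qubits b) (Qubits b) ℂ) := by
  ext i j
  simp only [qubitTensor, of_apply, Matrix.smul_apply, smul_eq_mul, Finset.prod_mul_distrib,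
    Finset.prod_const, Finset.card_univ, Fintype.card_fin, one_apply]
  congr 1
  rw [Fintype.prod_ite_zero]
  simp [funext_iff]

/-- The normalized Pauli matrix `σ / √2`. -/
abbrev normalizedPauli (a : Fin 4) : Matrix (Fin 2) (Fin 2) ℂ :=
  (((Real.sqrt 2)⁻¹ : ℝ) : ℂ) • pauliMatrix a

theorem pauliBasis_eq {b : ℕ} (k : Fin b → Fin 4) :
    pauliBasis b k = qubitTensor fun l => normalizedPauli (k l) := rfl

theorem inv_sqrt_two_mul_self :
    (((Real.sqrt 2)⁻¹ : ℝ) : ℂ) * (((Real.sqrt 2)⁻¹ : ℝ) : ℂ) = 1 / 2 := by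
  rw [← Complex.ofReal_mul, ← mul_inv, Real.mul_self_sqrt (by norm_num)]
  norm_num

theorem normalizedPauli_isHermitian (a : Fin 4) : (normalizedPauli a)ᴴ = normalizedPauli a := by
  rw [normalizedPauli, conjTranspose_smul]
  simp only [RCLike.star_def, Complex.conj_ofReal]
  congr 1
  fin_cases a <;> ext i j <;> fin_cases i <;> fin_cases j <;> simp [pauliMatrix]

theorem normalizedPauli_mul_self (a : Fin 4) :
    normalizedPauli a * normalizedPauli a = (1 / 2 : ℂ) • 1 := by
  rw [normalizedPauli, smul_mul_smul_comm, inv_sqrt_two_mul_self]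
  congr 1
  fin_cases a <;> ext i j <;> fin_cases i <;> fin_cases j <;>
    simp [pauliMatrix, mul_apply, Fin.sum_univ_two]

theorem sum_normalizedPauli_mul (i j i' j' : Fin 2) :
    ∑ a, normalizedPauli a i j * normalizedPauli a i' j' =
      if i = j' ∧ j = i' then 1 else 0 := by
  have h : ∀ a, normalizedPauli a i j * normalizedPauli a i' j' =
      1 / 2 * (pauliMatrix a i j * pauliMatrix a i' j') := fun a => by
    rw [← inv_sqrt_two_mul_self]
    simp only [normalizedPauli, Matrix.smul_apply, smul_eq_mul]
    ring
  have h0 : pauliMatrix 0 = !![1, 0; 0, 1] := rfl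
  have h1 : pauliMatrix 1 = !![0, -Complex.I; Complex.I, 0] := rfl
  have h2 : pauliMatrix 2 = !![0, 1; 1, 0] := rfl
  have h3 : pauliMatrix 3 = !![1, 0; 0, -1] := rfl
  simp only [h, Fin.sum_univ_four, h0, h1, h2, h3]
  fin_cases i <;> fin_cases j <;> fin_cases i' <;> fin_cases j' <;> norm_num

theorem pauliBasis_isHermitian {b : ℕ} (k : Fin b → Fin 4) : (pauliBasis b k).IsHermitian := by
  rw [IsHermitian, pauliBasis_eq, conjTranspose_qubitTensor]
  simp only [normalizedPauli_isHermitian]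

theorem pauliBasis_mul_self {b : ℕ} (k : Fin b → Fin 4) :
    pauliBasis b k * pauliBasis b k = ((1 / 2 : ℂ) ^ b) • 1 := by
  rw [pauliBasis_eq, qubitTensor_mul]
  simp only [normalizedPauli_mul_self, qubitTensor_smul_one]

/-- The completeness relation of the Pauli basis. -/
theorem sum_pauliBasis_mul {b : ℕ} (i j i' j' : Qubits b) :
    ∑ k, pauliBasis b k i j * pauliBasis b k i' j' = if i = j' ∧ j = i' then 1 else 0 := by
  simp only [pauliBasis_eq, qubitTensor, of_apply, ← Finset.prod_mul_distrib]
  rw [← Fintype.piFinset_univ, ← Finset.prod_univ_sum (fun _ => Finset.univ)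
    (fun l a => normalizedPauli a (i l) (j l) * normalizedPauli a (i' l) (j' l))]
  simp only [sum_normalizedPauli_mul]
  rw [Fintype.prod_ite_zero]
  simp [funext_iff, forall_and]

/-- Parseval's identity for the Pauli basis. -/
theorem sum_trace_mul_pauliBasis_sq {b : ℕ} (A : Matrix (Qubits b) (Qubits b) ℂ) :
    ∑ k, (A * pauliBasis b k).trace ^ 2 = (A * A).trace := by
  have h : ∀ k, (A * pauliBasis b k).trace ^ 2 = ∑ i, ∑ j, ∑ i', ∑ j',
      A i j * A i' j' * (pauliBasis b k j i * pauliBasis b k j' i') := by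
    intro k
    simp only [trace, diag_apply, mul_apply, pow_two, Finset.sum_mul_sum]
    refine Finset.sum_congr rfl fun i _ => ?_
    rw [Finset.sum_comm]
    refine Finset.sum_congr rfl fun j _ => Finset.sum_congr rfl fun i' _ =>
      Finset.sum_congr rfl fun j' _ => by ring
  simp only [h]
  rw [Finset.sum_comm]
  simp only [trace, diag_apply, mul_apply]
  refine Finset.sum_congr rfl fun i _ => ?_
  rw [Finset.sum_comm]
  refine Finset.sum_congr rfl fun j _ => ?_
  rw [Finset.sum_comm]
  simp only [Finset.sum_comm (s := Finset.univ (α := Fin b → Fin 4)), ← Finset.mul_sum,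
    sum_pauliBasis_mul]
  rw [Finset.sum_eq_single j, Finset.sum_eq_single i] <;> simp +contextual [eq_comm]

theorem pauliBasis_zero {b : ℕ} :
    pauliBasis b 0 = (((Real.sqrt 2)⁻¹ : ℝ) : ℂ) ^ b • 1 := by
  rw [← qubitTensor_smul_one, pauliBasis_eq]
  congr 1
  funext l
  simp only [normalizedPauli, Pi.zero_apply]
  congr 1
  ext i j
  fin_cases i <;> fin_cases j <;> simp [pauliMatrix]

theorem trace_pauliBasis {b : ℕ} {k : Fin b → Fin 4} (hk : k ≠ 0) :
    (pauliBasis b k).trace = 0 := by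
  obtain ⟨l, hl⟩ := Function.ne_iff.mp hk
  rw [pauliBasis_eq, trace_qubitTensor]
  refine Finset.prod_eq_zero (Finset.mem_univ l) ?_
  revert hl
  generalize k l = a
  intro ha
  fin_cases a <;> simp_all [trace, Fin.sum_univ_two, pauliMatrix]

/-- The Pauli coefficient `tr (A E_k)` times `√m`, `m = 2 ^ b`: for a state `A` it is the expectation
of the `±1`-valued outcome of measuring `√m E_k`. -/
def pauliCoeff {b : ℕ} (A : Matrix (Qubits b) (Qubits b) ℂ) (k : Fin b → Fin 4) : ℝ :=
  √(2 ^ b) * (A * pauliBasis b k).trace.re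

theorem trace_mul_isHermitian_im {ι : Type*} [Fintype ι] {A B : Matrix ι ι ℂ}
    (hA : A.IsHermitian) (hB : B.IsHermitian) : (A * B).trace.im = 0 := by
  have h : star (A * B).trace = (A * B).trace := by
    rw [← trace_conjTranspose, conjTranspose_mul, hA.eq, hB.eq, trace_mul_comm]
  exact Complex.conj_eq_iff_im.mp h

theorem sum_pauliCoeff_sq {b : ℕ} {A : Matrix (Qubits b) (Qubits b) ℂ} (hA : A.IsHermitian) :
    ∑ k, pauliCoeff A k ^ 2 = 2 ^ b * (A * A).trace.re := by
  rw [← sum_trace_mul_pauliBasis_sq, Complex.re_sum, Finset.mul_sum]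
  refine Finset.sum_congr rfl fun k _ => ?_
  have := trace_mul_isHermitian_im hA (pauliBasis_isHermitian k)
  rw [pauliCoeff, mul_pow, Real.sq_sqrt (by positivity), pow_two (trace _), Complex.mul_re, this]
  ring

theorem pauliCoeff_zero {b : ℕ} (A : Matrix (Qubits b) (Qubits b) ℂ) :
    pauliCoeff A 0 = A.trace.re := by
  have h2 : (2 : ℝ) ^ b = (√2 ^ b) ^ 2 := by
    rw [← pow_mul, mul_comm b 2, pow_mul, Real.sq_sqrt (by norm_num)]
  rw [pauliCoeff, pauliBasis_zero, mul_smul_comm, mul_one, trace_smul, smul_eq_mul,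
    ← Complex.ofReal_pow, Complex.re_ofReal_mul, h2, Real.sqrt_sq (by positivity), inv_pow,
    ← mul_assoc, mul_inv_cancel₀ (by positivity), one_mul]

theorem pauliCoeff_add {b : ℕ} (A B : Matrix (Qubits b) (Qubits b) ℂ) (k : Fin b → Fin 4) :
    pauliCoeff (A + B) k = pauliCoeff A k + pauliCoeff B k := by
  simp [pauliCoeff, add_mul, mul_add]

theorem pauliCoeff_sub {b : ℕ} (A B : Matrix (Qubits b) (Qubits b) ℂ) (k : Fin b → Fin 4) :
    pauliCoeff (A - B) k = pauliCoeff A k - pauliCoeff B k := by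
  simp [pauliCoeff, sub_mul, mul_sub]

theorem pauliCoeff_smul {b : ℕ} (t : ℝ) (A : Matrix (Qubits b) (Qubits b) ℂ) (k : Fin b → Fin 4) :
    pauliCoeff ((t : ℂ) • A) k = t * pauliCoeff A k := by
  simp [pauliCoeff]
  ring

/-! ### Outcomes of Pauli measurements -/

theorem spectrum_subset_of_mul_self {ι : Type*} [Fintype ι] [DecidableEq ι]
    {A : Matrix ι ι ℂ} {a : ℝ} (h : A * A = ((a ^ 2 : ℝ) : ℂ) • 1) :
    spectrum ℝ A ⊆ {a, -a} := by
  intro t ht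
  by_contra hne
  have hta : t ^ 2 - a ^ 2 ≠ 0 := by
    intro h0
    rcases sq_eq_sq_iff_eq_or_eq_neg.mp (sub_eq_zero.mp h0) with h1 | h1 <;> simp [h1] at hne
  have hta' : ((t : ℂ) ^ 2 - (a : ℂ) ^ 2) ≠ 0 := by exact_mod_cast hta
  refine ht ?_
  have hT : algebraMap ℝ (Matrix ι ι ℂ) t = (t : ℂ) • 1 := by
    rw [Algebra.algebraMap_eq_smul_one]; ext i j; simp
  refine IsUnit.of_mul_eq_one (((t : ℂ) ^ 2 - (a : ℂ) ^ 2)⁻¹ • ((t : ℂ) • 1 + A)) ?_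
  rw [hT, mul_smul_comm]
  have : ((t : ℂ) • 1 - A) * ((t : ℂ) • 1 + A) = ((t : ℂ) ^ 2 - (a : ℂ) ^ 2) • 1 := by
    rw [sub_mul, mul_add, mul_add, h]
    push_cast
    simp only [smul_mul_assoc, mul_smul_comm, one_mul, mul_one, sub_smul, pow_two, mul_smul]
    abel
  rw [this, smul_smul, inv_mul_cancel₀ hta', one_smul]

theorem eigenprojector_of_mul_self {ι : Type*} [Fintype ι] [DecidableEq ι]
    {A : Matrix ι ι ℂ} (hA : A.IsHermitian) {a : ℝ} (ha : a ≠ 0)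
    (h : A * A = ((a ^ 2 : ℝ) : ℂ) • 1) :
    eigenprojector A a = (1 / 2 : ℂ) • (1 + ((a⁻¹ : ℝ) : ℂ) • A) := by
  have hA' : IsSelfAdjoint A := hA
  have hs := spectrum_subset_of_mul_self h
  have h1 : eigenprojector A a = cfc (fun x : ℝ => 1 / 2 + (a⁻¹ / 2) * x) A := by
    refine cfc_congr fun x hx => ?_
    rcases hs hx with rfl | hx
    · simp only [Pi.single_eq_same]; field_simp; norm_num
    · rw [Set.mem_singleton_iff] at hx
      subst hx
      have : -a ≠ a := fun h => ha (by linarith)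
      simp only [Pi.single_eq_of_ne this]; field_simp; norm_num
  rw [h1, cfc_const_add (1 / 2 : ℝ) (fun x => (a⁻¹ / 2) * x) A, cfc_const_mul_id (a⁻¹ / 2) A,
    Algebra.algebraMap_eq_smul_one]
  ext i j
  simp only [Matrix.add_apply, Matrix.smul_apply, Complex.real_smul, smul_eq_mul]
  push_cast
  ring

/-- A real number outside the spectrum has zero eigenprojector, so that it may be added to the
possible outcomes of a measurement. -/
theorem eigenprojector_eq_zero {ι : Type*} [Fintype ι] [DecidableEq ι]
    {A : Matrix ι ι ℂ} {t : ℝ} (ht : t ∉ spectrum ℝ A) :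
    eigenprojector A t = 0 := by
  have : eigenprojector A t = cfc (fun _ : ℝ => (0 : ℝ)) A :=
    cfc_congr fun x hx => Pi.single_eq_of_ne (fun h : x = t => ht (h ▸ hx)) _
  rw [this, cfc_const_zero]

/-- Measuring an observable `A` with `A² = a²` yields `± a`, with probabilities
`tr (ρ (1 ± A / a)) / 2`. -/
theorem measurementLaw_of_mul_self {ι : Type*} [Fintype ι] [DecidableEq ι] (ρ : DensityMatrix ι)
    {A : Matrix ι ι ℂ} (hA : A.IsHermitian) {a : ℝ} (ha : 0 < a)
    (h : A * A = ((a ^ 2 : ℝ) : ℂ) • 1) :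
    measurementLaw ρ A =
      ENNReal.ofReal ((1 + a⁻¹ * (ρ.1 * A).trace.re) / 2) • Measure.dirac a +
      ENNReal.ofReal ((1 - a⁻¹ * (ρ.1 * A).trace.re) / 2) • Measure.dirac (-a) := by
  have hs := spectrum_subset_of_mul_self h
  have hne : a ≠ -a := by linarith
  have key : ∀ S : Set ℝ, MeasurableSet S → measurementLaw ρ A S =
      ∑ t ∈ ({a, -a} : Finset ℝ),
        ENNReal.ofReal (ρ.1 * eigenprojector A t).trace.re • Measure.dirac t S := by
    intro S hS
    rw [measurementLaw, Measure.sum_apply _ hS]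
    simp only [Measure.smul_apply]
    rw [tsum_subtype (spectrum ℝ A) (fun t =>
      ENNReal.ofReal (ρ.1 * eigenprojector A t).trace.re • Measure.dirac t S)]
    rw [tsum_eq_sum (s := ({a, -a} : Finset ℝ))]
    · refine Finset.sum_congr rfl fun t _ => ?_
      by_cases ht : t ∈ spectrum ℝ A
      · rw [Set.indicator_of_mem ht]
      · rw [Set.indicator_of_notMem ht, eigenprojector_eq_zero ht]; simp
    · intro t ht
      refine Set.indicator_of_notMem (fun h' => ht ?_) _
      simpa using hs h'
  have htr : ∀ s : ℝ, (ρ.1 * ((1 / 2 : ℂ) • (1 + (s : ℂ) • A))).trace.re =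
      (1 + s * (ρ.1 * A).trace.re) / 2 := by
    intro s
    rw [mul_smul_comm, mul_add, mul_one, mul_smul_comm, trace_smul, trace_add, trace_smul, ρ.2.2]
    have : (1 / 2 : ℂ) = ((1 / 2 : ℝ) : ℂ) := by norm_num
    rw [this, smul_eq_mul, Complex.re_ofReal_mul, Complex.add_re, smul_eq_mul,
      Complex.re_ofReal_mul, Complex.one_re]
    ring
  refine Measure.ext fun S hS => ?_
  rw [key S hS, Finset.sum_pair hne, eigenprojector_of_mul_self hA ha.ne' h, htr,
    eigenprojector_of_mul_self hA (neg_ne_zero.mpr ha.ne') (by rw [neg_sq]; exact h), htr, inv_neg,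
    Measure.add_apply, Measure.smul_apply, Measure.smul_apply]
  congr 4
  ring

/-- The sign encoded by a Boolean. -/
def boolSign (s : Bool) : ℝ := if s then 1 else -1

/-- The set of possible outcomes of one observation: which Pauli matrix was measured, and the sign
of the result. -/
abbrev Outcome (b : ℕ) : Type := (Fin b → Fin 4) × Bool

/-- The observation `(X, Y)` encoded by an outcome. -/
def Outcome.toObservation {b : ℕ} (x : Outcome b) : Observation b :=
  (pauliBasis b x.1, boolSign x.2 * (√(2 ^ b))⁻¹)

/-- The probability mass function of the outcome of one observation in the state `ρ`. The identity
`√m E_0` has the single eigenvalue `1`, and the formula gives its outcome `-1` probability zero. -/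
def outcomeProb {b : ℕ} (ρ : Matrix (Qubits b) (Qubits b) ℂ) (x : Outcome b) : ℝ :=
  (4 ^ b)⁻¹ * ((1 + boolSign x.2 * pauliCoeff ρ x.1) / 2)

theorem pauliBasis_mul_self' {b : ℕ} (k : Fin b → Fin 4) :
    pauliBasis b k * pauliBasis b k = ((((√(2 ^ b))⁻¹ ^ 2 : ℝ)) : ℂ) • 1 := by
  rw [pauliBasis_mul_self, inv_pow, Real.sq_sqrt (by positivity)]
  simp

open scoped MatrixOrder in
theorem trace_mul_nonneg {ι : Type*} [Fintype ι] {A B : Matrix ι ι ℂ} (hA : A.PosSemidef)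
    (hB : B.PosSemidef) : 0 ≤ (A * B).trace.re := by
  classical
  obtain ⟨C, rfl⟩ := CStarAlgebra.nonneg_iff_eq_star_mul_self.mp hB.nonneg
  rw [← mul_assoc, trace_mul_comm, ← mul_assoc]
  exact (Complex.le_def.mp (hA.mul_mul_conjTranspose_same C).trace_nonneg).1

theorem posSemidef_of_idempotent {ι : Type*} [Fintype ι] {P : Matrix ι ι ℂ}
    (hP : P.IsHermitian) (h : P * P = P) : P.PosSemidef := by
  rw [← h]
  nth_rw 1 [← hP.eq]
  exact posSemidef_conjTranspose_mul_self P

theorem abs_pauliCoeff_le_one {b : ℕ} (ρ : DensityMatrix (Qubits b)) (k : Fin b → Fin 4) :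
    |pauliCoeff ρ.1 k| ≤ 1 := by
  have key : ∀ s : ℝ, s ^ 2 = 1 → 0 ≤ 1 + s * pauliCoeff ρ.1 k := by
    intro s hs
    set E := pauliBasis b k
    -- the eigenprojector of `√m E_k` for the eigenvalue `s`
    set P : Matrix (Qubits b) (Qubits b) ℂ :=
      (1 / 2 : ℂ) • (1 + ((s * √(2 ^ b) : ℝ) : ℂ) • E) with hPdef
    have hPh : P.IsHermitian := by
      rw [IsHermitian, hPdef, conjTranspose_smul, conjTranspose_add, conjTranspose_smul,
        (pauliBasis_isHermitian k).eq]
      simp [E]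
    have hPP : P * P = P := by
      have h2 : ((s * √(2 ^ b) : ℝ) : ℂ) *
          (((s * √(2 ^ b) : ℝ) : ℂ) * (((√(2 ^ b))⁻¹ ^ 2 : ℝ) : ℂ)) = 1 := by
        rw [← Complex.ofReal_mul, ← Complex.ofReal_mul]
        have : √((2 : ℝ) ^ b) ≠ 0 := by positivity
        have : s * √(2 ^ b) * (s * √(2 ^ b) * (√(2 ^ b))⁻¹ ^ 2) = 1 := by
          field_simp; exact hs
        rw [this]; simp
      rw [hPdef, smul_mul_smul_comm, add_mul, mul_add, mul_add, smul_mul_smul_comm,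
        pauliBasis_mul_self', smul_smul, mul_assoc, h2]
      simp only [one_mul, mul_one, one_smul]
      ext i j
      simp only [Matrix.add_apply, Matrix.smul_apply, smul_eq_mul]
      ring
    have h0 := trace_mul_nonneg ρ.2.1 (posSemidef_of_idempotent hPh hPP)
    rw [hPdef, mul_smul_comm, mul_add, mul_one, mul_smul_comm, trace_smul, trace_add, trace_smul,
      ρ.2.2] at h0
    have h3 : (1 / 2 : ℂ) = ((1 / 2 : ℝ) : ℂ) := by norm_num
    rw [h3, smul_eq_mul, Complex.re_ofReal_mul, Complex.add_re, smul_eq_mul,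
      Complex.re_ofReal_mul, Complex.one_re] at h0
    rw [pauliCoeff, ← mul_assoc]
    linarith
  have h1 := key 1 (by norm_num)
  have h2 := key (-1) (by norm_num)
  rw [abs_le]
  constructor <;> linarith

theorem outcomeProb_nonneg {b : ℕ} (ρ : DensityMatrix (Qubits b)) (x : Outcome b) :
    0 ≤ outcomeProb ρ.1 x := by
  have := abs_le.mp (abs_pauliCoeff_le_one ρ x.1)
  rw [outcomeProb, boolSign]
  refine mul_nonneg (by positivity) ?_
  split_ifs <;> linarith

theorem sum_outcomeProb {b : ℕ} (A : Matrix (Qubits b) (Qubits b) ℂ) :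
    ∑ x, outcomeProb A x = 1 := by
  rw [Fintype.sum_prod_type]
  have : ∀ k : Fin b → Fin 4, ∑ s : Bool, outcomeProb A (k, s) = (4 ^ b : ℝ)⁻¹ := by
    intro k
    rw [Fintype.sum_bool]
    simp only [outcomeProb, boolSign]
    norm_num
    ring
  simp only [this]
  simp

/-- The distribution of the outcome of one observation. -/
def outcomeLaw {b : ℕ} (ρ : DensityMatrix (Qubits b)) : Measure (Outcome b) :=
  ∑ x, ENNReal.ofReal (outcomeProb ρ.1 x) • Measure.dirac x

instance {b : ℕ} (ρ : DensityMatrix (Qubits b)) : IsFiniteMeasure (outcomeLaw ρ) := by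
  rw [outcomeLaw]
  refine ⟨?_⟩
  simp only [Measure.finsetSum_apply, Measure.smul_apply, measure_univ, smul_eq_mul, mul_one]
  exact ENNReal.sum_lt_top.mpr fun x _ => ENNReal.ofReal_lt_top

theorem outcomeLaw_singleton {b : ℕ} (ρ : DensityMatrix (Qubits b)) (x : Outcome b) :
    outcomeLaw ρ {x} = ENNReal.ofReal (outcomeProb ρ.1 x) := by
  rw [outcomeLaw, Measure.finsetSum_apply, Finset.sum_eq_single x]
  · simp
  · intro y _ hy
    simp [hy]
  · simp

theorem map_outcomeLaw {b : ℕ} (ρ : DensityMatrix (Qubits b)) :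
    (outcomeLaw ρ).map Outcome.toObservation = observationLaw ρ := by
  have hm : Measurable (Outcome.toObservation (b := b)) := Measurable.of_discrete
  rw [outcomeLaw, Measure.map_finset_sum hm.aemeasurable, observationLaw, Fintype.sum_prod_type]
  refine Finset.sum_congr rfl fun k _ => ?_
  have ha : 0 < (√((2 : ℝ) ^ b))⁻¹ := by positivity
  have h4 : ((4 : ℝ≥0∞) ^ b)⁻¹ = ENNReal.ofReal ((4 ^ b)⁻¹) := by
    rw [ENNReal.ofReal_inv_of_pos (by positivity), ENNReal.ofReal_pow (by norm_num)]
    norm_num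
  rw [measurementLaw_of_mul_self ρ (pauliBasis_isHermitian k) ha (pauliBasis_mul_self' k), inv_inv,
    Measure.dirac_prod, Measure.map_add _ _ measurable_prodMk_left, Fintype.sum_bool,
    Measure.map_smul, Measure.map_smul, Measure.map_smul, Measure.map_smul,
    Measure.map_dirac' hm, Measure.map_dirac' hm, Measure.map_dirac' measurable_prodMk_left,
    Measure.map_dirac' measurable_prodMk_left, smul_add, smul_smul, smul_smul, h4,
    ← ENNReal.ofReal_mul (by positivity), ← ENNReal.ofReal_mul (by positivity)]
  simp [outcomeProb, Outcome.toObservation, boolSign, pauliCoeff, sub_eq_add_neg]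

/-- The law of the data is at least the sum of the probabilities of the outcomes in the event, for
an arbitrary (not necessarily measurable) event. -/
theorem sum_prod_outcomeProb_le_dataLaw {b n : ℕ} (ρ : DensityMatrix (Qubits b))
    (S : Set (Fin n → Observation b)) (T : Finset (Fin n → Outcome b))
    (hT : ∀ ω ∈ T, (fun i => (ω i).toObservation) ∈ S) :
    ENNReal.ofReal (∑ ω ∈ T, ∏ i, outcomeProb ρ.1 (ω i)) ≤ dataLaw n ρ S := by
  have hm : Measurable (Outcome.toObservation (b := b)) := Measurable.of_discrete
  have hmap : (Measure.pi fun _ : Fin n => outcomeLaw ρ).map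
      (fun ω i => (ω i).toObservation) = dataLaw n ρ := by
    have : SigmaFinite ((outcomeLaw ρ).map Outcome.toObservation) := inferInstance
    rw [dataLaw, ← map_outcomeLaw, Measure.pi_map_pi fun _ => hm.aemeasurable]
  rw [← hmap]
  refine le_trans ?_ (Measure.le_map_apply (Measurable.of_discrete.aemeasurable) S)
  refine le_trans ?_ (measure_mono (s := (T : Set (Fin n → Outcome b))) fun ω hω => hT ω hω)
  rw [← sum_measure_singleton, ENNReal.ofReal_sum_of_nonneg]
  · refine Finset.sum_le_sum fun ω _ => le_of_eq ?_
    rw [Measure.pi_singleton, ENNReal.ofReal_prod_of_nonneg fun i _ => outcomeProb_nonneg ρ _]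
    simp only [outcomeLaw_singleton]
  · exact fun ω _ => Finset.prod_nonneg fun i _ => outcomeProb_nonneg ρ _

/-! ### Testing many hypotheses against a common reference -/

theorem pauliCoeff_density_zero {b : ℕ} (ρ : DensityMatrix (Qubits b)) : pauliCoeff ρ.1 0 = 1 := by
  rw [pauliCoeff_zero, ρ.2.2, Complex.one_re]

/-- The outcome law in any state is absolutely continuous with respect to the one in the reference
state: the only outcome of probability zero there is the value `-1` of the identity. -/
theorem outcomeProb_eq_zero {b : ℕ} (ρ τ : DensityMatrix (Qubits b))
    (hτ : ∀ k ≠ 0, pauliCoeff τ.1 k ^ 2 ≤ 4 / 9) (x : Outcome b) (hx : outcomeProb τ.1 x = 0) :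
    outcomeProb ρ.1 x = 0 := by
  obtain ⟨k, s⟩ := x
  have h4 : ((4 : ℝ) ^ b)⁻¹ ≠ 0 := by positivity
  simp only [outcomeProb, mul_eq_zero, h4, false_or] at hx ⊢
  by_cases hk : k = 0
  · subst hk
    rwa [pauliCoeff_density_zero] at hx ⊢
  · have := hτ k hk
    have h1 : (boolSign s * pauliCoeff τ.1 k) ^ 2 ≤ 4 / 9 := by
      rw [mul_pow]
      have : boolSign s ^ 2 = 1 := by cases s <;> simp [boolSign]
      rw [this, one_mul]
      assumption
    nlinarith

/-- The `χ²`-divergence of one observation is at most `2 · ‖ρ - τ‖₂² / m` as soon as the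
nontrivial Pauli coefficients of the reference state `τ` stay away from `± 1`. -/
theorem sum_outcomeProb_sq_div_le {b : ℕ} (ρ τ : DensityMatrix (Qubits b))
    (hτ : ∀ k ≠ 0, pauliCoeff τ.1 k ^ 2 ≤ 4 / 9) :
    ∑ x, outcomeProb ρ.1 x ^ 2 / outcomeProb τ.1 x ≤
      1 + 2 * ((ρ.1 - τ.1) * (ρ.1 - τ.1)).trace.re / 2 ^ b := by
  have key : ∀ k : Fin b → Fin 4,
      ∑ s : Bool, outcomeProb ρ.1 (k, s) ^ 2 / outcomeProb τ.1 (k, s) ≤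
        (4 ^ b : ℝ)⁻¹ * (1 + 2 * pauliCoeff (ρ.1 - τ.1) k ^ 2) := by
    intro k
    have h4 : 0 < ((4 : ℝ) ^ b)⁻¹ := by positivity
    rw [Fintype.sum_bool, pauliCoeff_sub]
    simp only [outcomeProb, boolSign, if_true, Bool.false_eq_true, if_false, one_mul]
    generalize ((4 : ℝ) ^ b)⁻¹ = w at h4
    by_cases hk : k = 0
    -- the identity: the outcome `-1` contributes `0 / 0 = 0`
    · subst hk
      rw [pauliCoeff_density_zero, pauliCoeff_density_zero]
      norm_num
      field_simp
      norm_num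
    · have hc := hτ k hk
      generalize pauliCoeff τ.1 k = c at hc
      generalize pauliCoeff ρ.1 k = d
      have h1 : 0 < 1 + c := by nlinarith
      have h2 : 0 < 1 - c := by nlinarith
      have h3 : 0 < 1 - c ^ 2 := by linarith
      have : (w * ((1 + d) / 2)) ^ 2 / (w * ((1 + c) / 2)) +
          (w * ((1 + -1 * d) / 2)) ^ 2 / (w * ((1 + -1 * c) / 2)) =
          w * (1 + (d - c) ^ 2 / (1 - c ^ 2)) := by
        have e : 1 - c ^ 2 = (1 + c) * (1 - c) := by ring
        rw [e, neg_one_mul, neg_one_mul, ← sub_eq_add_neg, ← sub_eq_add_neg]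
        field_simp
        ring
      rw [this]
      have : (d - c) ^ 2 / (1 - c ^ 2) ≤ 2 * (d - c) ^ 2 := by
        rw [div_le_iff₀ h3]
        nlinarith [sq_nonneg (d - c)]
      gcongr
  rw [Fintype.sum_prod_type]
  refine (Finset.sum_le_sum fun k _ => key k).trans (le_of_eq ?_)
  rw [← Finset.mul_sum, Finset.sum_add_distrib, ← Finset.mul_sum,
    sum_pauliCoeff_sq (ρ.2.1.isHermitian.sub τ.2.1.isHermitian)]
  have h4 : (4 : ℝ) ^ b = 2 ^ b * 2 ^ b := by rw [← mul_pow]; norm_num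
  simp only [Finset.sum_const, Finset.card_univ, Fintype.card_pi, Fintype.card_fin,
    Finset.prod_const, nsmul_eq_mul, mul_one]
  push_cast
  rw [h4]
  field_simp

/-- **Lower bound for testing multiple hypotheses.** If the states `ρ j` are so close to a reference
state `τ`, not necessarily of low rank, that the second moment of the likelihood ratio of the data
is at most the square root of the number of hypotheses, and no estimate is good for two of them,
then every estimator is bad for one of them with probability at least `1 / 8`. -/
theorem minimaxProb_ge {b n r : ℕ} {J : Type*} [Fintype J] (hJ : 2 ≤ Fintype.card J)
    (ρ : J → DensityMatrix (Qubits b)) (hr : ∀ j, ρ j ∈ lowRankStates (Qubits b) r)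
    (τ : DensityMatrix (Qubits b)) (hτ : ∀ k ≠ 0, pauliCoeff τ.1 k ^ 2 ≤ 4 / 9)
    (hχ : ∀ j, n * (2 * (((ρ j).1 - τ.1) * ((ρ j).1 - τ.1)).trace.re / 2 ^ b) ≤
      Real.log (Fintype.card J) / 2)
    {Bad : DensityMatrix (Qubits b) → DensityMatrix (Qubits b) → Prop}
    (hBad : ∀ σ j k, j ≠ k → Bad σ (ρ j) ∨ Bad σ (ρ k)) :
    ENNReal.ofReal (1 / 8) ≤ minimaxProb b n r Bad := by
  classical
  refine le_iInf fun f => ?_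
  have hN : (2 : ℝ) ≤ (Fintype.card J : ℝ) := by exact_mod_cast hJ
  set N : ℝ := (Fintype.card J : ℝ)
  let p : DensityMatrix (Qubits b) → (Fin n → Outcome b) → ℝ :=
    fun ρ ω => ∏ i, outcomeProb ρ.1 (ω i)
  have hp0 : ∀ ρ ω, 0 ≤ p ρ ω := fun ρ ω => Finset.prod_nonneg fun i _ => outcomeProb_nonneg ρ _
  have hp1 : ∀ ρ, ∑ ω, p ρ ω = 1 := by
    intro ρ
    have := Finset.prod_univ_sum (fun _ : Fin n => (Finset.univ : Finset (Outcome b)))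
      (fun _ x => outcomeProb ρ.1 x)
    rw [Fintype.piFinset_univ] at this
    rw [← this]
    simp [sum_outcomeProb]
  -- the data for which the estimate is good for the `j`-th hypothesis
  let A : J → Finset (Fin n → Outcome b) := fun j =>
    Finset.univ.filter fun ω => ¬ Bad (f.1 fun i => (ω i).toObservation) (ρ j)
  -- the second moment of the likelihood ratio tensorizes
  have hD : ∀ j, ∑ ω, p (ρ j) ω ^ 2 / p τ ω ≤ √N := by
    intro j
    have h1 := Finset.prod_univ_sum (fun _ : Fin n => (Finset.univ : Finset (Outcome b)))
      (fun _ x => outcomeProb (ρ j).1 x ^ 2 / outcomeProb τ.1 x)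
    rw [Fintype.piFinset_univ] at h1
    have h2 : ∑ ω, p (ρ j) ω ^ 2 / p τ ω =
        (∑ x, outcomeProb (ρ j).1 x ^ 2 / outcomeProb τ.1 x) ^ n := by
      simp only [p, ← Finset.prod_pow, ← Finset.prod_div_distrib]
      rw [← h1]
      simp
    rw [h2]
    calc (∑ x, outcomeProb (ρ j).1 x ^ 2 / outcomeProb τ.1 x) ^ n
        ≤ (Real.exp (2 * (((ρ j).1 - τ.1) * ((ρ j).1 - τ.1)).trace.re / 2 ^ b)) ^ n := by
          refine pow_le_pow_left₀ (Finset.sum_nonneg fun x _ =>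
            div_nonneg (sq_nonneg _) (outcomeProb_nonneg τ x)) ?_ n
          refine (sum_outcomeProb_sq_div_le (ρ j) τ hτ).trans ?_
          rw [add_comm]
          exact Real.add_one_le_exp _
      _ ≤ Real.exp (Real.log N / 2) := by
          rw [← Real.exp_nat_mul]
          exact Real.exp_le_exp.mpr (hχ j)
      _ = √N := by
          rw [← Real.log_sqrt (by linarith), Real.exp_log (Real.sqrt_pos.mpr (by linarith))]
  -- change of measure to the reference state, by the Cauchy–Schwarz inequality
  have hCS : ∀ j, (∑ ω ∈ A j, p (ρ j) ω) ^ 2 ≤ √N * ∑ ω ∈ A j, p τ ω := by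
    intro j
    refine (Finset.sum_sq_le_sum_mul_sum_of_sq_le_mul (A j)
      (f := fun ω => p (ρ j) ω ^ 2 / p τ ω) (g := p τ)
      (fun ω _ => div_nonneg (sq_nonneg _) (hp0 _ _)) (fun ω _ => hp0 _ _) fun ω _ => ?_).trans ?_
    · by_cases h : p τ ω = 0
      · obtain ⟨i, _, hi⟩ := Finset.prod_eq_zero_iff.mp h
        have : p (ρ j) ω = 0 :=
          Finset.prod_eq_zero (Finset.mem_univ i) (outcomeProb_eq_zero (ρ j) τ hτ _ hi)
        simp [this]
      · exact le_of_eq (by field_simp)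
    · refine mul_le_mul_of_nonneg_right ((Finset.sum_le_sum_of_subset_of_nonneg
        (Finset.subset_univ _) fun ω _ _ => div_nonneg (sq_nonneg _) (hp0 _ _)).trans (hD j))
        (Finset.sum_nonneg fun ω _ => hp0 _ _)
  have hdisj : ∑ j, ∑ ω ∈ A j, p τ ω ≤ 1 := by
    rw [← hp1 τ, ← Finset.sum_biUnion]
    · exact Finset.sum_le_sum_of_subset_of_nonneg (Finset.subset_univ _) fun ω _ _ => hp0 _ _
    · intro j _ k _ hjk
      refine Finset.disjoint_left.mpr fun ω hj hk => ?_
      simp only [A, Finset.mem_filter] at hj hk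
      exact (hBad _ j k hjk).elim hj.2 hk.2
  obtain ⟨j, hj⟩ : ∃ j, ∑ ω ∈ A j, p (ρ j) ω ≤ 7 / 8 := by
    by_contra! hcon
    have h1 : N * (7 / 8) ≤ ∑ j, ∑ ω ∈ A j, p (ρ j) ω := by
      have := Finset.sum_le_sum fun j (_ : j ∈ Finset.univ) => (hcon j).le
      simpa using this
    have h2 : (∑ j, ∑ ω ∈ A j, p (ρ j) ω) ^ 2 ≤ N * √N := by
      refine (sq_sum_le_card_mul_sum_sq (s := Finset.univ)).trans ?_
      rw [Finset.card_univ]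
      refine mul_le_mul_of_nonneg_left ?_ (by linarith)
      refine (Finset.sum_le_sum fun j _ => hCS j).trans ?_
      rw [← Finset.mul_sum]
      exact mul_le_of_le_one_right (Real.sqrt_nonneg _) hdisj
    have h3 : (N * (7 / 8)) ^ 2 ≤ N * √N := (pow_le_pow_left₀ (by linarith) h1 2).trans h2
    have hs : √N ^ 2 = N := Real.sq_sqrt (by linarith)
    have hs1 : 1.414 ≤ √N := Real.le_sqrt_of_sq_le (by norm_num; linarith)
    have h4 : √N ^ 3 * (√N * (49 / 64)) ≤ √N ^ 3 * 1 := by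
      calc _ = (√N ^ 2 * (7 / 8)) ^ 2 := by ring
        _ ≤ √N ^ 2 * √N := by rw [hs]; exact h3
        _ = _ := by ring
    have h5 := le_of_mul_le_mul_left h4 (by positivity)
    linarith
  refine le_iSup₂_of_le (ρ j) (hr j) ?_
  refine le_trans (ENNReal.ofReal_le_ofReal ?_)
    (sum_prod_outcomeProb_le_dataLaw (ρ j) _ (A j)ᶜ fun ω hω => ?_)
  · have := Finset.sum_add_sum_compl (A j) (p (ρ j))
    rw [hp1] at this
    change 1 / 8 ≤ ∑ ω ∈ (A j)ᶜ, p (ρ j) ω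
    linarith
  · simpa [A] using hω

/-! ### A pure state with small Pauli coefficients -/

/-- A unit vector of `ℂ²` whose Bloch vector has the rational coordinates `2/3, 2/3, 1/3`, all of
them less than `1`. -/
def qubitVector : Fin 2 → ℂ := ![2 * ((√6)⁻¹ : ℝ), (1 + Complex.I) * ((√6)⁻¹ : ℝ)]

/-- The `b`-fold tensor power of `qubitVector`, a unit vector in the space of `b` qubits. -/
def refVector (b : ℕ) : Qubits b → ℂ := fun i => ∏ l, qubitVector (i l)

/-- The pure state of `refVector`, as a matrix. -/
abbrev refProjector (b : ℕ) : Matrix (Qubits b) (Qubits b) ℂ :=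
  vecMulVec (refVector b) (star (refVector b))

theorem refProjector_eq (b : ℕ) :
    refProjector b = qubitTensor fun _ => vecMulVec qubitVector (star qubitVector) := by
  ext i j
  simp [refVector, qubitTensor, vecMulVec_apply, Finset.prod_mul_distrib]

theorem inv_sqrt_six_mul_self : (((√6)⁻¹ : ℝ) : ℂ) * (((√6)⁻¹ : ℝ) : ℂ) = 1 / 6 := by
  rw [← Complex.ofReal_mul, ← mul_inv, Real.mul_self_sqrt (by norm_num)]
  norm_num

theorem vecMulVec_qubitVector : vecMulVec qubitVector (star qubitVector) =
    (1 / 6 : ℂ) • !![4, 2 - 2 * Complex.I; 2 + 2 * Complex.I, 2] := by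
  rw [← inv_sqrt_six_mul_self]
  have hI := Complex.I_mul_I
  ext i j
  fin_cases i <;> fin_cases j <;> simp [vecMulVec_apply, qubitVector]
  · ring
  · ring
  · ring
  · linear_combination (-(√6 : ℂ)⁻¹ * (√6 : ℂ)⁻¹) * hI

/-- The coordinates `1, 2/3, 2/3, 1/3` of `qubitVector` in the Pauli basis. -/
def blochCoeff : Fin 4 → ℝ := ![1, 2 / 3, 2 / 3, 1 / 3]

theorem trace_vecMulVec_qubitVector_mul (a : Fin 4) :
    (vecMulVec qubitVector (star qubitVector) * normalizedPauli a).trace =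
      (((√2)⁻¹ * blochCoeff a : ℝ) : ℂ) := by
  have h0 : pauliMatrix 0 = !![1, 0; 0, 1] := rfl
  have h1 : pauliMatrix 1 = !![0, -Complex.I; Complex.I, 0] := rfl
  have h2 : pauliMatrix 2 = !![0, 1; 1, 0] := rfl
  have h3 : pauliMatrix 3 = !![1, 0; 0, -1] := rfl
  rw [normalizedPauli, mul_smul_comm, trace_smul, smul_eq_mul, Complex.ofReal_mul,
    vecMulVec_qubitVector, smul_mul_assoc, trace_smul, smul_eq_mul]
  congr 1
  have hI := Complex.I_mul_I
  fin_cases a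
  · simp only [Fin.zero_eta, h0, blochCoeff]
    simp [trace, Fin.sum_univ_two]; norm_num
  · simp only [Fin.mk_one, h1, blochCoeff]
    simp [trace, Fin.sum_univ_two]; linear_combination (-2 / 3 : ℂ) * hI
  · simp only [Fin.reduceFinMk, h2, blochCoeff]
    simp [trace, Fin.sum_univ_two]; norm_num
  · simp only [Fin.reduceFinMk, h3, blochCoeff]
    simp [trace, Fin.sum_univ_two]; norm_num

theorem pauliCoeff_refProjector {b : ℕ} (k : Fin b → Fin 4) :
    pauliCoeff (refProjector b) k = ∏ l, blochCoeff (k l) := by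
  rw [pauliCoeff, refProjector_eq, pauliBasis_eq, qubitTensor_mul, trace_qubitTensor]
  simp only [trace_vecMulVec_qubitVector_mul]
  rw [← Complex.ofReal_prod, Complex.ofReal_re, Finset.prod_mul_distrib, Finset.prod_const,
    Finset.card_univ, Fintype.card_fin]
  have : √((2 : ℝ) ^ b) = √2 ^ b := by
    rw [Real.sqrt_eq_iff_mul_self_eq (by positivity) (by positivity), ← mul_pow,
      Real.mul_self_sqrt (by norm_num)]
  rw [this, ← mul_assoc, ← mul_pow, mul_inv_cancel₀ (by positivity), one_pow, one_mul]

theorem pauliCoeff_refProjector_sq_le {b : ℕ} {k : Fin b → Fin 4} (hk : k ≠ 0) :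
    pauliCoeff (refProjector b) k ^ 2 ≤ 4 / 9 := by
  obtain ⟨l, hl⟩ := Function.ne_iff.mp hk
  rw [pauliCoeff_refProjector, ← Finset.prod_pow, ← Finset.mul_prod_erase _ _ (Finset.mem_univ l)]
  have h1 : ∀ a, blochCoeff a ^ 2 ≤ 1 := fun a => by
    fin_cases a <;> norm_num [blochCoeff]
  have h2 : blochCoeff (k l) ^ 2 ≤ 4 / 9 := by
    revert hl
    generalize k l = a
    intro ha
    fin_cases a <;> simp_all [blochCoeff] <;> norm_num
  calc _ ≤ 4 / 9 * 1 := mul_le_mul h2 (Finset.prod_le_one (fun _ _ => sq_nonneg _)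
            fun _ _ => h1 _) (Finset.prod_nonneg fun _ _ => sq_nonneg _) (by norm_num)
    _ = 4 / 9 := by norm_num

theorem star_refVector_dotProduct (b : ℕ) : star (refVector b) ⬝ᵥ refVector b = 1 := by
  have h : (refProjector b).trace = 1 := by
    rw [refProjector_eq, trace_qubitTensor, vecMulVec_qubitVector]
    simp [trace, Fin.sum_univ_two]
    norm_num
  rw [← h, trace_vecMulVec, dotProduct_comm]

/-! ### Star projections and the Hilbert–Schmidt norm -/

section HermitianMatrices

variable {ι κ : Type*} [Fintype ι] [Fintype κ]

/-- The squared Hilbert–Schmidt (Frobenius) norm. -/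
def hsSq (A : Matrix ι κ ℂ) : ℝ := ∑ i, ∑ j, ‖A i j‖ ^ 2

theorem hsSq_eq_trace (A : Matrix ι κ ℂ) : hsSq A = (Aᴴ * A).trace.re := by
  simp only [hsSq, trace, diag_apply, mul_apply, conjTranspose_apply, Complex.re_sum]
  rw [Finset.sum_comm]
  refine Finset.sum_congr rfl fun i _ => Finset.sum_congr rfl fun j _ => ?_
  rw [RCLike.star_def, Complex.conj_mul', ← Complex.ofReal_pow, Complex.ofReal_re]

theorem hsSq_eq_trace' (A : Matrix ι κ ℂ) : hsSq A = (A * Aᴴ).trace.re := by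
  rw [hsSq_eq_trace, trace_mul_comm]

theorem hsSq_of_isHermitian {A : Matrix ι ι ℂ} (hA : A.IsHermitian) :
    hsSq A = (A * A).trace.re := by rw [hsSq_eq_trace, hA.eq]

theorem hsSq_nonneg (A : Matrix ι κ ℂ) : 0 ≤ hsSq A :=
  Finset.sum_nonneg fun _ _ => Finset.sum_nonneg fun _ _ => sq_nonneg _

/-- The Cauchy–Schwarz inequality for the Hilbert–Schmidt inner product. -/
theorem norm_trace_conjTranspose_mul_le (A B : Matrix ι κ ℂ) :
    ‖(Aᴴ * B).trace‖ ≤ √(hsSq A) * √(hsSq B) := by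
  have h : (Aᴴ * B).trace = ∑ x : ι × κ, star (A x.1 x.2) * B x.1 x.2 := by
    simp only [trace, diag_apply, mul_apply, conjTranspose_apply, Fintype.sum_prod_type]
    rw [Finset.sum_comm]
  rw [h]
  refine (norm_sum_le _ _).trans ?_
  simp only [norm_mul, norm_star]
  refine (Real.sum_mul_le_sqrt_mul_sqrt _ _ _).trans (le_of_eq ?_)
  simp only [hsSq, Fintype.sum_prod_type]

theorem isHermitian_of_isStarProjection {P : Matrix ι ι ℂ} (hP : IsStarProjection P) :
    P.IsHermitian := hP.isSelfAdjoint

theorem mul_self_of_isStarProjection {P : Matrix ι ι ℂ} (hP : IsStarProjection P) :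
    P * P = P := hP.isIdempotentElem

theorem posSemidef_of_isStarProjection {P : Matrix ι ι ℂ} (hP : IsStarProjection P) :
    P.PosSemidef :=
  posSemidef_of_idempotent (isHermitian_of_isStarProjection hP) (mul_self_of_isStarProjection hP)

theorem norm_diag_of_isStarProjection {P : Matrix ι ι ℂ} (hP : IsStarProjection P) (i : ι) :
    ‖P i i‖ = (P i i).re ∧ ‖P i i‖ ≤ 1 := by
  have hre : ‖P i i‖ = (P i i).re :=
    (Complex.re_eq_norm.mpr (posSemidef_of_isStarProjection hP).diag_nonneg).symm
  refine ⟨hre, ?_⟩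
  have h : (P i i).re = ∑ j, ‖P i j‖ ^ 2 := by
    conv_lhs => rw [← mul_self_of_isStarProjection hP]
    rw [mul_apply, Complex.re_sum]
    refine Finset.sum_congr rfl fun j _ => ?_
    rw [← (isHermitian_of_isStarProjection hP).apply j i, RCLike.star_def, Complex.mul_conj',
      ← Complex.ofReal_pow, Complex.ofReal_re]
  have h2 : ‖P i i‖ ^ 2 ≤ ‖P i i‖ := by
    rw [hre, h]
    conv_lhs => rw [← h, ← hre]
    exact Finset.single_le_sum (f := fun j => ‖P i j‖ ^ 2) (fun _ _ => sq_nonneg _)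
      (Finset.mem_univ i)
  nlinarith [norm_nonneg (P i i)]

theorem isStarProjection_conj [DecidableEq ι] {P : Matrix ι ι ℂ} (hP : IsStarProjection P)
    (U : unitaryGroup ι ℂ) : IsStarProjection ((U : Matrix ι ι ℂ)ᴴ * P * U) := by
  have hU : (U : Matrix ι ι ℂ) * (U : Matrix ι ι ℂ)ᴴ = 1 := Unitary.mul_star_self_of_mem U.2
  refine ⟨?_, ?_⟩
  · calc ((U : Matrix ι ι ℂ)ᴴ * P * U) * ((U : Matrix ι ι ℂ)ᴴ * P * U)
        = (U : Matrix ι ι ℂ)ᴴ * P * ((U : Matrix ι ι ℂ) * (U : Matrix ι ι ℂ)ᴴ) * P * (U : Matrix ι ι ℂ) := by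
          simp only [mul_assoc]
      _ = (U : Matrix ι ι ℂ)ᴴ * (P * P) * (U : Matrix ι ι ℂ) := by rw [hU, mul_one]; simp only [mul_assoc]
      _ = _ := by rw [mul_self_of_isStarProjection hP]
  · change ((U : Matrix ι ι ℂ)ᴴ * P * (U : Matrix ι ι ℂ))ᴴ = _
    rw [conjTranspose_mul, conjTranspose_mul, conjTranspose_conjTranspose,
      (isHermitian_of_isStarProjection hP).eq, mul_assoc]

/-! ### Duality for Schatten norms -/

/-- Hölder's inequality for the Schatten norm, against a difference of two orthogonal projections
whose ranks add up to at most `R`. -/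
theorem re_trace_mul_sub_le_schattenNorm [DecidableEq ι] {q : ℝ≥0∞} (hq : 1 ≤ q)
    {A : Matrix ι ι ℂ} (hA : A.IsHermitian) {P Q : Matrix ι ι ℂ} (hP : IsStarProjection P)
    (hQ : IsStarProjection Q) {R : ℝ} (hR : P.trace.re + Q.trace.re ≤ R) :
    (A * (P - Q)).trace.re ≤ schattenNorm q hA * R ^ (1 - (q⁻¹).toReal) := by
  set U := hA.eigenvectorUnitary
  set P' := (U : Matrix ι ι ℂ)ᴴ * P * U with hP'
  set Q' := (U : Matrix ι ι ℂ)ᴴ * Q * U with hQ'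
  have hUU : (U : Matrix ι ι ℂ) * (U : Matrix ι ι ℂ)ᴴ = 1 := Unitary.mul_star_self_of_mem U.2
  have hp := norm_diag_of_isStarProjection (isStarProjection_conj hP U)
  have hq' := norm_diag_of_isStarProjection (isStarProjection_conj hQ U)
  rw [← hP'] at hp
  rw [← hQ'] at hq'
  have htr : ∀ B : Matrix ι ι ℂ, ((U : Matrix ι ι ℂ)ᴴ * B * U).trace = B.trace := fun B => by
    rw [trace_mul_comm, ← mul_assoc, hUU, one_mul]
  set β : ι → ℝ := fun i => ‖(P' - Q') i i‖
  have hβ0 : ∀ i, 0 ≤ β i := fun i => norm_nonneg _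
  have hsub : ∀ i, (P' - Q') i i = ((P' i i).re - (Q' i i).re : ℝ) := fun i => by
    rw [Matrix.sub_apply]
    have h1 := Complex.re_eq_norm.mp (hp i).1.symm
    have h2 := Complex.re_eq_norm.mp (hq' i).1.symm
    apply Complex.ext <;> simp [(Complex.le_def.mp h1).2.symm, (Complex.le_def.mp h2).2.symm]
  have hβ1 : ∀ i, β i ≤ 1 := fun i => by
    simp only [β, hsub, Complex.norm_real, Real.norm_eq_abs]
    have := (hp i); have := hq' i
    rw [abs_le]
    constructor <;> linarith [norm_nonneg (P' i i), norm_nonneg (Q' i i), (hp i).1, (hp i).2,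
      (hq' i).1, (hq' i).2]
  have hβR : ∑ i, β i ≤ R := by
    refine le_trans ?_ hR
    rw [← htr P, ← htr Q, ← hP', ← hQ', trace, trace, Complex.re_sum, Complex.re_sum,
      ← Finset.sum_add_distrib]
    refine Finset.sum_le_sum fun i _ => ?_
    simp only [β, Matrix.sub_apply, diag_apply]
    rw [← (hp i).1, ← (hq' i).1]
    exact norm_sub_le _ _
  -- in the eigenbasis of `A`, the diagonal entries `β` of `P - Q` are weights of total mass `≤ R`
  have hle : (A * (P - Q)).trace.re ≤ ∑ i, β i * |hA.eigenvalues i| := by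
    have hA' : A = U * diagonal (fun i => (hA.eigenvalues i : ℂ)) * (U : Matrix ι ι ℂ)ᴴ := by
      conv_lhs => rw [hA.spectral_theorem, Unitary.conjStarAlgAut_apply]
      rfl
    have h1 : (A * (P - Q)).trace = ∑ i, (hA.eigenvalues i : ℂ) * (P' - Q') i i := by
      have : P' - Q' = (U : Matrix ι ι ℂ)ᴴ * (P - Q) * U := by rw [mul_sub, sub_mul]
      conv_lhs => rw [hA', mul_assoc, trace_mul_comm, ← mul_assoc, ← this,
        trace_mul_comm]
      simp [trace, diagonal_mul]
    rw [h1, Complex.re_sum]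
    refine Finset.sum_le_sum fun i _ => ?_
    refine (Complex.re_le_norm _).trans ?_
    rw [norm_mul, Complex.norm_real, Real.norm_eq_abs, mul_comm]
  refine hle.trans ?_
  have : Fact (1 ≤ q) := ⟨hq⟩
  have hR0 : 0 ≤ R := (Finset.sum_nonneg fun i _ => hβ0 i).trans hβR
  by_cases hq1 : q = ∞
  · subst hq1
    simp only [ENNReal.inv_top, ENNReal.toReal_zero, sub_zero, Real.rpow_one]
    rw [mul_comm]
    refine le_trans ?_ (mul_le_mul_of_nonneg_right hβR (norm_nonneg _))
    rw [Finset.sum_mul]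
    refine Finset.sum_le_sum fun i _ => mul_le_mul_of_nonneg_left ?_ (hβ0 i)
    exact PiLp.norm_apply_le (WithLp.toLp ∞ hA.eigenvalues) i
  · have hp1 : 1 ≤ q.toReal := by
      rw [← ENNReal.toReal_one]
      exact ENNReal.toReal_mono hq1 hq
    have hp0 : 0 < q.toReal := by linarith
    refine (Real.inner_le_weight_mul_Lp_of_nonneg Finset.univ hp1 β _ hβ0
      fun i => abs_nonneg _).trans ?_
    rw [schattenNorm, PiLp.norm_eq_sum hp0, ENNReal.toReal_inv, mul_comm, one_div]
    have h1 : 0 ≤ 1 - q.toReal⁻¹ := by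
      rw [sub_nonneg]; exact inv_le_one_of_one_le₀ hp1
    refine mul_le_mul ?_ (Real.rpow_le_rpow (Finset.sum_nonneg fun i _ => hβ0 i) hβR h1)
      (by positivity) (by positivity)
    refine Real.rpow_le_rpow (Finset.sum_nonneg fun i _ => mul_nonneg (hβ0 i) (by positivity)) ?_
      (by positivity)
    refine Finset.sum_le_sum fun i _ => mul_le_of_le_one_left (by positivity) (hβ1 i)

/-- If `tr ((ρ - τ) (P - Q)) ≥ 2 t R ^ (1 - 1/q)` for projections `P`, `Q` of total rank `R`, then
no state is within Schatten distance less than `t` of both `ρ` and `τ`. -/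
theorem le_schattenDist_or [DecidableEq ι] {q : ℝ≥0∞} (hq : 1 ≤ q) (σ ρ τ : DensityMatrix ι)
    {P Q : Matrix ι ι ℂ} (hP : IsStarProjection P) (hQ : IsStarProjection Q) {R t : ℝ} (hR0 : 0 < R)
    (hR : P.trace.re + Q.trace.re ≤ R)
    (ht : 2 * t * R ^ (1 - (q⁻¹).toReal) ≤ ((ρ.1 - τ.1) * (P - Q)).trace.re) :
    t ≤ schattenDist q σ ρ ∨ t ≤ schattenDist q σ τ := by
  by_contra! hcon
  have h1 := re_trace_mul_sub_le_schattenNorm hq (σ.2.1.isHermitian.sub ρ.2.1.isHermitian) hQ hP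
    (R := R) (by linarith)
  have h2 := re_trace_mul_sub_le_schattenNorm hq (σ.2.1.isHermitian.sub τ.2.1.isHermitian) hP hQ hR
  have e : ((ρ.1 - τ.1) * (P - Q)).trace.re =
      ((σ.1 - ρ.1) * (Q - P)).trace.re + ((σ.1 - τ.1) * (P - Q)).trace.re := by
    rw [← Complex.add_re, ← trace_add]
    congr 2
    noncomm_ring
  have hRq : 0 < R ^ (1 - (q⁻¹).toReal) := Real.rpow_pos_of_pos hR0 _
  have h3 := mul_lt_mul_of_pos_right hcon.1 hRq
  have h4 := mul_lt_mul_of_pos_right hcon.2 hRq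
  rw [schattenDist] at h3 h4
  linarith

/-! ### Lower bounds for the Bures distance and the Kullback–Leibler divergence -/

theorem continuousOn_spectrum [DecidableEq ι] (A : Matrix ι ι ℂ) (f : ℝ → ℝ) :
    ContinuousOn f (spectrum ℝ A) :=
  (finite_real_spectrum (A := A)).continuousOn f

theorem cfc_mul_cfc [DecidableEq ι] (f g : ℝ → ℝ) (A : Matrix ι ι ℂ) :
    cfc f A * cfc g A = cfc (fun x => f x * g x) A :=
  (cfc_mul f g A (continuousOn_spectrum A f) (continuousOn_spectrum A g)).symm

theorem isHermitian_cfc [DecidableEq ι] (f : ℝ → ℝ) (A : Matrix ι ι ℂ) : (cfc f A).IsHermitian :=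
  cfc_predicate f A

theorem spectrum_nonneg [DecidableEq ι] {A : Matrix ι ι ℂ} (hA : A.PosSemidef) {x : ℝ}
    (hx : x ∈ spectrum ℝ A) : 0 ≤ x := by
  rw [hA.isHermitian.spectrum_real_eq_range_eigenvalues] at hx
  obtain ⟨i, rfl⟩ := hx
  exact hA.eigenvalues_nonneg i

theorem cfc_sqrt_mul_self [DecidableEq ι] {A : Matrix ι ι ℂ} (hA : A.PosSemidef) :
    cfc Real.sqrt A * cfc Real.sqrt A = A := by
  have hA' : IsSelfAdjoint A := hA.isHermitian
  rw [cfc_mul_cfc]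
  conv_rhs => rw [← cfc_id' ℝ A]
  exact cfc_congr fun x hx => Real.mul_self_sqrt (spectrum_nonneg hA hx)

/-- For any contraction `W`, the overlap `tr (√ρ √σ W)` of two states is at most the Hellinger
affinity of the outcomes of a measurement of the projection `P`. -/
theorem norm_trace_sqrt_mul_sqrt_mul_le [DecidableEq ι] (ρ σ : DensityMatrix ι)
    {P W : Matrix ι ι ℂ} (hP : IsStarProjection P) (hW : (1 - W * Wᴴ).PosSemidef) :
    ‖(cfc Real.sqrt ρ.1 * cfc Real.sqrt σ.1 * W).trace‖ ≤
      √(ρ.1 * P).trace.re * √(σ.1 * P).trace.re +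
      √(1 - (ρ.1 * P).trace.re) * √(1 - (σ.1 * P).trace.re) := by
  set R := cfc Real.sqrt ρ.1 with hR
  set S := cfc Real.sqrt σ.1 with hS
  have hRh : Rᴴ = R := isHermitian_cfc _ _
  have hSh : Sᴴ = S := isHermitian_cfc _ _
  have hRR : R * R = ρ.1 := cfc_sqrt_mul_self ρ.2.1
  have hSS : S * S = σ.1 := cfc_sqrt_mul_self σ.2.1
  have key : ∀ Q : Matrix ι ι ℂ, IsStarProjection Q →
      ‖(R * Q * S * W).trace‖ ≤ √(ρ.1 * Q).trace.re * √(σ.1 * Q).trace.re := by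
    intro Q hQ
    have hQh : Qᴴ = Q := isHermitian_of_isStarProjection hQ
    have hQQ := mul_self_of_isStarProjection hQ
    have e : R * Q * S * W = (Q * R)ᴴ * (Q * S * W) := by
      rw [conjTranspose_mul, hRh, hQh]
      calc R * Q * S * W = R * (Q * Q) * S * W := by rw [hQQ]
        _ = _ := by simp only [mul_assoc]
    rw [e]
    refine (norm_trace_conjTranspose_mul_le _ _).trans ?_
    refine mul_le_mul (Real.sqrt_le_sqrt (le_of_eq ?_)) (Real.sqrt_le_sqrt ?_)
      (Real.sqrt_nonneg _) (Real.sqrt_nonneg _)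
    · rw [hsSq_eq_trace', conjTranspose_mul, hRh, hQh, ← mul_assoc, mul_assoc Q R R, hRR,
        trace_mul_comm, ← mul_assoc, hQQ, trace_mul_comm]
    · have h1 : (Q * S * W) * (Q * S * W)ᴴ =
          Q * σ.1 * Q - (Q * S) * (1 - W * Wᴴ) * (Q * S)ᴴ := by
        rw [conjTranspose_mul, conjTranspose_mul, hSh, hQh, ← hSS]
        noncomm_ring
      have h2 := (Complex.le_def.mp (hW.mul_mul_conjTranspose_same (Q * S)).trace_nonneg).1
      rw [hsSq_eq_trace', h1, trace_sub, Complex.sub_re]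
      have h3 : (Q * σ.1 * Q).trace = (σ.1 * Q).trace := by
        rw [trace_mul_comm, ← mul_assoc, hQQ, trace_mul_comm]
      rw [h3]
      simp only [Complex.zero_re] at h2
      linarith
  have hsplit : R * S * W = R * P * S * W + R * (1 - P) * S * W := by noncomm_ring
  have hc : ∀ τ : DensityMatrix ι, (τ.1 * (1 - P)).trace.re = 1 - (τ.1 * P).trace.re := fun τ => by
    rw [mul_sub, mul_one, trace_sub, τ.2.2, Complex.sub_re, Complex.one_re]
  have h2 := key (1 - P) hP.one_sub
  rw [hc, hc] at h2
  rw [hsplit, trace_add]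
  exact (norm_add_le _ _).trans (add_le_add (key P hP) h2)

theorem sq_sqrt_sub_sqrt_le {p q : ℝ} (hp0 : 0 ≤ p) (hp1 : p ≤ 1) (hq0 : 0 ≤ q) (hq1 : q ≤ 1) :
    (√p - √q) ^ 2 ≤ 2 - 2 * (√p * √q + √(1 - p) * √(1 - q)) := by
  nlinarith [Real.sq_sqrt hp0, Real.sq_sqrt hq0, Real.sq_sqrt (sub_nonneg.mpr hp1),
    Real.sq_sqrt (sub_nonneg.mpr hq1), sq_nonneg (√(1 - p) - √(1 - q))]

theorem trace_mul_projection_mem_Icc [DecidableEq ι] (ρ : DensityMatrix ι) {P : Matrix ι ι ℂ}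
    (hP : IsStarProjection P) : 0 ≤ (ρ.1 * P).trace.re ∧ (ρ.1 * P).trace.re ≤ 1 := by
  refine ⟨trace_mul_nonneg ρ.2.1 (posSemidef_of_isStarProjection hP), ?_⟩
  have := trace_mul_nonneg ρ.2.1 (posSemidef_of_isStarProjection hP.one_sub)
  rw [mul_sub, mul_one, trace_sub, ρ.2.2, Complex.sub_re, Complex.one_re] at this
  linarith

/-- The overlap defining the Bures distance is `tr (√ρ √σ W)` for a partial isometry `W`, namely the
polar part of `√σ √ρ`. -/
theorem exists_trace_sqrt_eq [DecidableEq ι] (ρ σ : DensityMatrix ι) :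
    ∃ W : Matrix ι ι ℂ, (1 - W * Wᴴ).PosSemidef ∧
      (cfc Real.sqrt (cfc Real.sqrt ρ.1 * σ.1 * cfc Real.sqrt ρ.1)).trace =
        (cfc Real.sqrt ρ.1 * cfc Real.sqrt σ.1 * W).trace := by
  set R := cfc Real.sqrt ρ.1 with hR
  set S := cfc Real.sqrt σ.1 with hS
  have hRh : Rᴴ = R := isHermitian_cfc _ _
  have hSh : Sᴴ = S := isHermitian_cfc _ _
  have hSS : S * S = σ.1 := cfc_sqrt_mul_self σ.2.1
  set M := R * σ.1 * R with hM
  have hMA : M = (S * R)ᴴ * (S * R) := by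
    rw [conjTranspose_mul, hRh, hSh, hM, ← hSS]; simp only [mul_assoc]
  have hMpos : M.PosSemidef := by rw [hMA]; exact posSemidef_conjTranspose_mul_self _
  have hM' : IsSelfAdjoint M := hMpos.isHermitian
  set G := cfc (fun x => (√x)⁻¹) M with hG
  have hGh : Gᴴ = G := isHermitian_cfc _ _
  have hMid : cfc (fun x : ℝ => x) M = M := cfc_id' ℝ M
  have hMG : M * G = cfc Real.sqrt M := by
    conv_lhs => rw [hG, ← hMid, hMid]
    nth_rw 1 [← hMid]
    rw [cfc_mul_cfc]
    exact cfc_congr fun x _ => Real.div_sqrt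
  have hGMGG : G * M * G * G = G := by
    have : G * M * G * G = G * (cfc Real.sqrt M) * G := by rw [← hMG]; simp only [mul_assoc]
    rw [this, hG, cfc_mul_cfc, cfc_mul_cfc]
    refine cfc_congr fun x _ => ?_
    by_cases h : √x = 0
    · simp [h]
    · field_simp
  refine ⟨S * R * G, ?_, ?_⟩
  · have hWh : ((S * R * G) * (S * R * G)ᴴ).IsHermitian := isHermitian_mul_conjTranspose_self _
    have hWW : ((S * R * G) * (S * R * G)ᴴ) * ((S * R * G) * (S * R * G)ᴴ) =
        (S * R * G) * (S * R * G)ᴴ := by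
      have e : (S * R * G)ᴴ = G * (S * R)ᴴ := by rw [conjTranspose_mul, hGh]
      rw [e]
      calc _ = S * R * G * (G * ((S * R)ᴴ * (S * R)) * G * G) * (S * R)ᴴ := by
            simp only [mul_assoc]
        _ = _ := by rw [← hMA, hGMGG]; simp only [mul_assoc]
    exact posSemidef_of_isStarProjection
      (IsStarProjection.one_sub (p := (S * R * G) * (S * R * G)ᴴ) ⟨hWW, hWh⟩)
  · rw [← hMG]
    congr 1
    rw [hM, ← hSS]
    simp only [mul_assoc]

/-- The Bures distance dominates the Hellinger distance of the outcomes of a two-valued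
measurement. -/
theorem sq_sqrt_sub_sqrt_le_buresSq [DecidableEq ι] (ρ σ : DensityMatrix ι) {P : Matrix ι ι ℂ}
    (hP : IsStarProjection P) :
    (√(ρ.1 * P).trace.re - √(σ.1 * P).trace.re) ^ 2 ≤ buresSq ρ σ := by
  obtain ⟨W, hW, h⟩ := exists_trace_sqrt_eq ρ σ
  have h1 := norm_trace_sqrt_mul_sqrt_mul_le ρ σ hP hW
  obtain ⟨hp0, hp1⟩ := trace_mul_projection_mem_Icc ρ hP
  obtain ⟨hq0, hq1⟩ := trace_mul_projection_mem_Icc σ hP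
  refine (sq_sqrt_sub_sqrt_le hp0 hp1 hq0 hq1).trans ?_
  rw [buresSq, h]
  linarith [Complex.re_le_norm (cfc Real.sqrt ρ.1 * cfc Real.sqrt σ.1 * W).trace]

/-- The trace of `f(A) g(B)` as a double sum over the eigenvalues of `A` and `B`, with the squared
overlaps of the eigenvectors as weights. -/
theorem trace_cfc_mul_cfc [DecidableEq ι] {A B : Matrix ι ι ℂ} (hA : A.IsHermitian)
    (hB : B.IsHermitian) : ∃ w : ι → ι → ℝ, (∀ i j, 0 ≤ w i j) ∧
      ∀ f g : ℝ → ℝ, (cfc f A * cfc g B).trace.re =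
        ∑ i, ∑ j, w i j * (f (hA.eigenvalues i) * g (hB.eigenvalues j)) := by
  set U : Matrix ι ι ℂ := (hA.eigenvectorUnitary : Matrix ι ι ℂ)
  set V : Matrix ι ι ℂ := (hB.eigenvectorUnitary : Matrix ι ι ℂ)
  refine ⟨fun i j => ‖(Uᴴ * V) i j‖ ^ 2, fun _ _ => sq_nonneg _, fun f g => ?_⟩
  have h1 : cfc f A = U * diagonal (fun i => (f (hA.eigenvalues i) : ℂ)) * Uᴴ := by
    rw [hA.cfc_eq, IsHermitian.cfc, Unitary.conjStarAlgAut_apply]; rfl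
  have h2 : cfc g B = V * diagonal (fun i => (g (hB.eigenvalues i) : ℂ)) * Vᴴ := by
    rw [hB.cfc_eq, IsHermitian.cfc, Unitary.conjStarAlgAut_apply]; rfl
  set D := diagonal (fun i => (f (hA.eigenvalues i) : ℂ)) with hD
  set E := diagonal (fun i => (g (hB.eigenvalues i) : ℂ)) with hE
  have h3 : (cfc f A * cfc g B).trace = (D * (Uᴴ * V) * (E * (Uᴴ * V)ᴴ)).trace := by
    rw [h1, h2, mul_assoc U D, mul_assoc U, trace_mul_comm, conjTranspose_mul,
      conjTranspose_conjTranspose]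
    simp only [mul_assoc]
  rw [h3, trace, Complex.re_sum]
  refine Finset.sum_congr rfl fun i _ => ?_
  rw [diag_apply, mul_apply, Complex.re_sum]
  refine Finset.sum_congr rfl fun j _ => ?_
  rw [hD, hE, diagonal_mul, diagonal_mul, conjTranspose_apply]
  have : ∀ z : ℂ, ∀ a b : ℝ, ((a : ℂ) * z * ((b : ℂ) * star z)).re = ‖z‖ ^ 2 * (a * b) := by
    intro z a b
    have : (a : ℂ) * z * ((b : ℂ) * star z) = ((‖z‖ ^ 2 * (a * b) : ℝ) : ℂ) := by
      rw [mul_mul_mul_comm, RCLike.star_def, Complex.mul_conj']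
      push_cast; ring
    rw [this, Complex.ofReal_re]
  exact this _ _ _

/-- The scalar inequality which, summed over pairs of eigenvalues, bounds the Kullback–Leibler
divergence below by `2 - 2 tr (√ρ √σ)`. -/
theorem two_mul_sub_le_mul_log {p q : ℝ} (hp : 0 ≤ p) (hq : 0 < q) :
    2 * p - 2 * (√p * √q) ≤ p * Real.log p - p * Real.log q := by
  rcases hp.eq_or_lt with rfl | hp
  · simp
  have h1 : Real.log (√q / √p) ≤ √q / √p - 1 := Real.log_le_sub_one_of_pos (by positivity)
  rw [Real.log_div (by positivity) (by positivity), Real.log_sqrt hq.le, Real.log_sqrt hp.le] at h1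
  have h2 : p * (√q / √p) = √p * √q := by
    rw [mul_div_assoc', div_eq_iff (by positivity)]
    linear_combination (-√q) * Real.mul_self_sqrt hp.le
  nlinarith [mul_le_mul_of_nonneg_left h1 hp.le]

/-- The Kullback–Leibler divergence dominates the Hellinger distance of the outcomes of a two-valued
measurement. -/
theorem sq_sqrt_sub_sqrt_le_klDivergence [DecidableEq ι] (ρ σ : DensityMatrix ι)
    {P : Matrix ι ι ℂ} (hP : IsStarProjection P) :
    (((√(ρ.1 * P).trace.re - √(σ.1 * P).trace.re) ^ 2 : ℝ) : EReal) ≤ klDivergence ρ σ := by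
  rw [klDivergence]
  split_ifs with hσ
  swap
  · exact le_top
  rw [EReal.coe_le_coe_iff]
  obtain ⟨hp0, hp1⟩ := trace_mul_projection_mem_Icc ρ hP
  obtain ⟨hq0, hq1⟩ := trace_mul_projection_mem_Icc σ hP
  refine (sq_sqrt_sub_sqrt_le hp0 hp1 hq0 hq1).trans ?_
  have hW : (1 - (1 : Matrix ι ι ℂ) * (1 : Matrix ι ι ℂ)ᴴ).PosSemidef := by
    rw [conjTranspose_one, one_mul, sub_self]; exact PosSemidef.zero
  have h1 := norm_trace_sqrt_mul_sqrt_mul_le ρ σ hP hW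
  rw [mul_one] at h1
  have h2 := (Complex.re_le_norm _).trans h1
  have hρ' : IsSelfAdjoint ρ.1 := ρ.2.1.isHermitian
  have hσ' : IsSelfAdjoint σ.1 := σ.2.1.isHermitian
  obtain ⟨w, hw, hwt⟩ := trace_cfc_mul_cfc ρ.2.1.isHermitian σ.2.1.isHermitian
  have e1 : (1 : ℝ) = ∑ i, ∑ j, w i j * (ρ.2.1.isHermitian.eigenvalues i * 1) := by
    rw [← hwt (fun x => x) (fun _ => 1), cfc_id' ℝ ρ.1, cfc_const_one ℝ σ.1, mul_one, ρ.2.2,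
      Complex.one_re]
  have e2 : (ρ.1 * (cfc Real.log ρ.1 - cfc Real.log σ.1)).trace.re =
      (cfc (fun x => x * Real.log x) ρ.1 * cfc (fun _ => (1 : ℝ)) σ.1).trace.re -
        (cfc (fun x : ℝ => x) ρ.1 * cfc Real.log σ.1).trace.re := by
    rw [← cfc_mul_cfc, cfc_id' ℝ ρ.1, cfc_const_one ℝ σ.1, mul_one, mul_sub, trace_sub,
      Complex.sub_re]
  have h3 : 2 - 2 * (cfc Real.sqrt ρ.1 * cfc Real.sqrt σ.1).trace.re ≤
      (ρ.1 * (cfc Real.log ρ.1 - cfc Real.log σ.1)).trace.re := by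
    rw [e2, hwt, hwt, hwt]
    have e3 : (2 : ℝ) = 2 * ∑ i, ∑ j, w i j * (ρ.2.1.isHermitian.eigenvalues i * 1) := by
      rw [← e1, mul_one]
    nth_rw 1 [e3]
    simp only [Finset.mul_sum, ← Finset.sum_sub_distrib]
    refine Finset.sum_le_sum fun i _ => Finset.sum_le_sum fun j _ => ?_
    have := mul_le_mul_of_nonneg_left (two_mul_sub_le_mul_log (ρ.2.1.eigenvalues_nonneg i)
      (hσ.eigenvalues_pos j)) (hw i j)
    linarith
  linarith

theorem sq_le_sq_sqrt_sub_or {x y z t : ℝ} (ht : 0 ≤ t) (h : 2 * t ≤ |x - y|) :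
    t ^ 2 ≤ (x - z) ^ 2 ∨ t ^ 2 ≤ (y - z) ^ 2 := by
  by_contra! hcon
  have h1 := abs_lt_of_sq_lt_sq hcon.1 ht
  have h2 := abs_lt_of_sq_lt_sq hcon.2 ht
  have : |x - y| ≤ |x - z| + |y - z| := by
    rw [abs_sub_comm y z]; exact abs_sub_le x z y
  linarith

end HermitianMatrices

/-! ### Sign codes -/

theorem boolSign_mul_self (s : Bool) : boolSign s * boolSign s = 1 := by
  cases s <;> simp [boolSign]

theorem sq_boolSign_sub (s t : Bool) : (boolSign s - boolSign t) ^ 2 = if s ≠ t then 4 else 0 := by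
  cases s <;> cases t <;> norm_num [boolSign]

theorem sum_sq_boolSign_sub {α : Type*} [Fintype α] (θ η : α → Bool) :
    ∑ i, (boolSign (θ i) - boolSign (η i)) ^ 2 = 4 * hammingDist θ η := by
  simp only [sq_boolSign_sub, hammingDist]
  rw [Finset.sum_ite, Finset.sum_const_zero, add_zero, Finset.sum_const, nsmul_eq_mul, mul_comm]

theorem sum_pow_hammingDist {α : Type*} [Fintype α] [DecidableEq α] (η : α → Bool) :
    ∑ θ : α → Bool, (1 / 4 : ℝ) ^ hammingDist θ η = (5 / 4) ^ Fintype.card α := by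
  have h1 : ∀ θ : α → Bool, (1 / 4 : ℝ) ^ hammingDist θ η =
      ∏ i, if θ i ≠ η i then (1 / 4 : ℝ) else 1 := by
    intro θ
    rw [Finset.prod_ite, Finset.prod_const, Finset.prod_const_one, mul_one, hammingDist]
  have h2 := Finset.prod_univ_sum (fun _ : α => (Finset.univ : Finset Bool))
    (fun i s => if s ≠ η i then (1 / 4 : ℝ) else 1)
  rw [Fintype.piFinset_univ] at h2
  simp only [h1]
  rw [← h2]
  have h3 : ∀ s : Bool, ∑ t : Bool, (if t ≠ s then (1 / 4 : ℝ) else 1) = 5 / 4 := by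
    intro s; cases s <;> norm_num
  simp only [h3, Finset.prod_const, Finset.card_univ]

theorem card_hammingBall_le {α : Type*} [Fintype α] [DecidableEq α] (η : α → Bool) :
    ((Finset.univ.filter fun θ : α → Bool => 8 * hammingDist θ η < Fintype.card α).card : ℝ) ≤
      Real.exp (Fintype.card α * (1 / 4 + Real.log 2 / 4)) := by
  set N := Fintype.card α
  set B := Finset.univ.filter fun θ : α → Bool => 8 * hammingDist θ η < N
  have h4 : Real.log 4 = 2 * Real.log 2 := by
    rw [show (4 : ℝ) = 2 ^ 2 by norm_num, Real.log_pow]; norm_num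
  have h1 : (B.card : ℝ) * Real.exp (-(N * (Real.log 2 / 4))) ≤ (5 / 4) ^ N := by
    rw [← sum_pow_hammingDist η]
    refine le_trans ?_ (Finset.sum_le_sum_of_subset_of_nonneg (Finset.subset_univ B)
      fun _ _ _ => by positivity)
    rw [← nsmul_eq_mul]
    refine Finset.card_nsmul_le_sum _ _ _ fun θ hθ => ?_
    have hθ' : 8 * hammingDist θ η < N := (Finset.mem_filter.mp hθ).2
    have hθ'' : (8 : ℝ) * hammingDist θ η ≤ N := by exact_mod_cast hθ'.le
    have : (1 / 4 : ℝ) = Real.exp (-Real.log 4) := by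
      rw [Real.exp_neg, Real.exp_log (by norm_num)]; norm_num
    rw [this, ← Real.exp_nat_mul, h4]
    refine Real.exp_le_exp.mpr ?_
    nlinarith [Real.log_nonneg (show (1 : ℝ) ≤ 2 by norm_num)]
  have h5 : (5 / 4 : ℝ) ^ N ≤ Real.exp (N * (1 / 4)) := by
    rw [Real.exp_nat_mul]
    refine pow_le_pow_left₀ (by norm_num) ?_ N
    have := Real.add_one_le_exp (1 / 4 : ℝ)
    linarith
  have h6 := h1.trans h5
  rw [Real.exp_neg, ← div_eq_mul_inv, div_le_iff₀ (Real.exp_pos _), ← Real.exp_add] at h6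
  rwa [mul_add]

/-- The Gilbert–Varshamov bound: a set containing half of all sign patterns of length `N ≥ 8` has a
subset of size at least `exp (N / 8)` with Hamming distances at least `N / 8`. -/
theorem exists_sign_code {α : Type*} [Fintype α] [DecidableEq α] (hN : 8 ≤ Fintype.card α)
    (S : Finset (α → Bool)) (hS : (2 : ℝ) ^ Fintype.card α ≤ 2 * S.card) :
    ∃ J ⊆ S, (Fintype.card α : ℝ) / 8 ≤ Real.log J.card ∧ 2 ≤ J.card ∧
      ∀ θ ∈ J, ∀ η ∈ J, θ ≠ η → Fintype.card α ≤ 8 * hammingDist θ η := by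
  classical
  set N := Fintype.card α
  let F := S.powerset.filter fun J => ∀ θ ∈ J, ∀ η ∈ J, θ ≠ η → N ≤ 8 * hammingDist θ η
  obtain ⟨J, hJF, hJmax⟩ := F.exists_max_image Finset.card
    ⟨∅, Finset.mem_filter.mpr ⟨Finset.empty_mem_powerset S, by simp⟩⟩
  obtain ⟨hJS, hJ⟩ := Finset.mem_filter.mp hJF
  rw [Finset.mem_powerset] at hJS
  -- by maximality, the balls around the points of `J` cover `S`
  have hcov : S ⊆ J.biUnion fun η => Finset.univ.filter fun θ => 8 * hammingDist θ η < N := by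
    intro θ hθ
    simp only [Finset.mem_biUnion, Finset.mem_filter, Finset.mem_univ, true_and]
    by_contra! hcon
    have hθJ : θ ∉ J := fun h => by
      have := hcon θ h
      rw [hammingDist_self] at this
      omega
    have := hJmax (insert θ J) (Finset.mem_filter.mpr ⟨Finset.mem_powerset.mpr
      (Finset.insert_subset hθ hJS), ?_⟩)
    · rw [Finset.card_insert_of_notMem hθJ] at this
      omega
    · intro x hx y hy hxy
      rcases Finset.mem_insert.mp hx with hx | hx <;> rcases Finset.mem_insert.mp hy with hy | hy
      · exact absurd (hx.trans hy.symm) hxy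
      · rw [hx]; exact hcon y hy
      · rw [hy, hammingDist_comm]; exact hcon x hx
      · exact hJ x hx y hy hxy
  have hcard : (S.card : ℝ) ≤ J.card * Real.exp (N * (1 / 4 + Real.log 2 / 4)) := by
    have h1 : (S.card : ℝ) ≤ ∑ η ∈ J,
        ((Finset.univ.filter fun θ : α → Bool => 8 * hammingDist θ η < N).card : ℝ) := by
      exact_mod_cast (Finset.card_le_card hcov).trans Finset.card_biUnion_le
    refine h1.trans ?_
    rw [← nsmul_eq_mul]
    exact Finset.sum_le_card_nsmul _ _ _ fun η _ => card_hammingBall_le η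
  have h2N : (0 : ℝ) < 2 ^ N := by positivity
  have hJpos : (0 : ℝ) < J.card := by
    by_contra! h
    have : (J.card : ℝ) = 0 := le_antisymm h (Nat.cast_nonneg _)
    rw [this, zero_mul] at hcard
    linarith
  have hNr : (8 : ℝ) ≤ N := by exact_mod_cast hN
  have hlog : (N : ℝ) / 8 ≤ Real.log J.card := by
    have h1 : (2 : ℝ) ^ N ≤ 2 * (J.card * Real.exp (N * (1 / 4 + Real.log 2 / 4))) := by linarith
    have h2 := Real.log_le_log h2N h1
    rw [Real.log_pow, Real.log_mul (by norm_num) (by positivity), Real.log_mul hJpos.ne'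
      (Real.exp_pos _).ne', Real.log_exp] at h2
    nlinarith [Real.log_two_gt_d9, Real.log_two_lt_d9]
  refine ⟨J, hJS, hlog, ?_, hJ⟩
  by_contra! h
  have : (J.card : ℝ) ≤ 1 := by exact_mod_cast Nat.lt_succ_iff.mp h
  have := Real.log_nonpos hJpos.le this
  linarith

/-! ### Typical sign matrices -/

/-- The squared Hilbert–Schmidt norm of the Gram matrix of the columns of a sign matrix. -/
def gramSq {α β : Type*} [Fintype α] [Fintype β] (θ : α × β → Bool) : ℝ :=
  ∑ i, ∑ j, (∑ k, boolSign (θ (k, i)) * boolSign (θ (k, j))) ^ 2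

theorem sum_boolSign_mul_eq_zero {α β : Type*} [Fintype α] [Fintype β] [DecidableEq α]
    [DecidableEq β] {k l : α} {i j : β} (hkl : k ≠ l) (hij : i ≠ j) :
    ∑ θ : α × β → Bool, boolSign (θ (k, i)) * boolSign (θ (k, j)) *
      (boolSign (θ (l, i)) * boolSign (θ (l, j))) = 0 := by
  -- flipping one of the four signs changes the sign of the product
  refine Finset.sum_involution (fun θ _ => Function.update θ (k, i) (!θ (k, i))) ?_ ?_ ?_ ?_
  · intro θ _
    rw [Function.update_self, Function.update_of_ne (by simp [hij.symm]),
      Function.update_of_ne (by simp [hkl.symm]), Function.update_of_ne (by simp [hkl.symm])]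
    have : boolSign (!θ (k, i)) = -boolSign (θ (k, i)) := by
      cases θ (k, i) <;> simp [boolSign]
    rw [this]; ring
  · intro θ _ _ h
    have := congrFun h (k, i)
    simp at this
  · simp
  · intro θ _
    simp

theorem sum_gramSq_le {α β : Type*} [Fintype α] [Fintype β] [DecidableEq α] [DecidableEq β]
    (h : Fintype.card β ≤ Fintype.card α) :
    ∑ θ : α × β → Bool, gramSq θ ≤
      2 ^ (Fintype.card (α × β)) * (2 * Fintype.card β * (Fintype.card α : ℝ) ^ 2) := by
  have hsK : (Fintype.card β : ℝ) ≤ (Fintype.card α : ℝ) := by exact_mod_cast h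
  set K : ℝ := (Fintype.card α : ℝ) with hK
  set s : ℝ := (Fintype.card β : ℝ) with hs
  set T : ℝ := 2 ^ (Fintype.card (α × β)) with hT
  have hT0 : 0 ≤ T := by positivity
  have hcard : ∑ θ : α × β → Bool, (1 : ℝ) = T := by
    rw [Finset.sum_const, Finset.card_univ, Fintype.card_fun, Fintype.card_bool, nsmul_eq_mul]
    push_cast
    rw [mul_one]
  have key : ∀ i j : β, ∑ θ : α × β → Bool,
      (∑ k, boolSign (θ (k, i)) * boolSign (θ (k, j))) ^ 2 ≤
        T * ((if i = j then K ^ 2 else 0) + K) := by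
    intro i j
    have hK0 : 0 ≤ K := Nat.cast_nonneg _
    split_ifs with hij
    · subst hij
      simp only [boolSign_mul_self]
      rw [← hcard, Finset.sum_mul]
      refine Finset.sum_le_sum fun θ _ => ?_
      rw [Finset.sum_const, Finset.card_univ, nsmul_eq_mul, mul_one, one_mul]
      linarith
    · simp only [pow_two, Finset.sum_mul_sum]
      rw [Finset.sum_comm]
      rw [zero_add, mul_comm T, hK, ← nsmul_eq_mul, ← Finset.card_univ]
      refine Finset.sum_le_card_nsmul _ _ _ fun k _ => ?_
      rw [Finset.sum_comm, Finset.sum_eq_single k]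
      · rw [← hcard]
        refine Finset.sum_le_sum fun θ _ => le_of_eq ?_
        rw [mul_mul_mul_comm, boolSign_mul_self, boolSign_mul_self, mul_one]
      · intro l _ hl
        exact sum_boolSign_mul_eq_zero hl.symm hij
      · simp
  simp only [gramSq]
  rw [Finset.sum_comm]
  calc ∑ i : β, ∑ θ : α × β → Bool, ∑ j, (∑ k, boolSign (θ (k, i)) * boolSign (θ (k, j))) ^ 2
      ≤ ∑ i : β, ∑ j : β, T * ((if i = j then K ^ 2 else 0) + K) := by
        refine Finset.sum_le_sum fun i _ => ?_
        rw [Finset.sum_comm]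
        exact Finset.sum_le_sum fun j _ => key i j
    _ = T * (s * (K ^ 2 + s * K)) := by
        simp only [← Finset.mul_sum, Finset.sum_add_distrib, Finset.sum_ite_eq, Finset.mem_univ,
          if_true, Finset.sum_const, Finset.card_univ, nsmul_eq_mul, ← hs]
        ring
    _ ≤ T * (2 * s * K ^ 2) := by
        refine mul_le_mul_of_nonneg_left ?_ hT0
        have hs0 : 0 ≤ s := Nat.cast_nonneg _
        nlinarith [mul_nonneg hs0 (mul_nonneg (hs0.trans hsK) (sub_nonneg.mpr hsK))]

/-- At least half of all sign matrices have columns whose Gram matrix has Hilbert–Schmidt norm of the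
order of that of a multiple of the identity. -/
theorem half_le_card_typical {α β : Type*} [Fintype α] [Fintype β] [DecidableEq α] [DecidableEq β]
    (hβ : 1 ≤ Fintype.card β) (h : Fintype.card β ≤ Fintype.card α) :
    (2 : ℝ) ^ (Fintype.card (α × β)) ≤ 2 * (Finset.univ.filter fun θ : α × β → Bool =>
      gramSq θ ≤ 4 * Fintype.card β * (Fintype.card α : ℝ) ^ 2).card := by
  set M : ℝ := 2 * Fintype.card β * (Fintype.card α : ℝ) ^ 2 with hM
  have hM0 : 0 < M := by
    have h1 : (1 : ℝ) ≤ Fintype.card β := by exact_mod_cast hβ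
    have h2 : (1 : ℝ) ≤ Fintype.card α := by exact_mod_cast hβ.trans h
    positivity
  have h4 : 4 * Fintype.card β * (Fintype.card α : ℝ) ^ 2 = 2 * M := by rw [hM]; ring
  rw [h4]
  set S := Finset.univ.filter fun θ : α × β → Bool => gramSq θ ≤ 2 * M
  have h1 : (Sᶜ.card : ℝ) * (2 * M) ≤ 2 ^ (Fintype.card (α × β)) * M := by
    refine le_trans ?_ (sum_gramSq_le h)
    refine le_trans ?_ (Finset.sum_le_sum_of_subset_of_nonneg (Finset.subset_univ Sᶜ)
      fun θ _ _ => Finset.sum_nonneg fun i _ => Finset.sum_nonneg fun j _ => sq_nonneg _)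
    rw [← nsmul_eq_mul]
    refine Finset.card_nsmul_le_sum _ _ _ fun θ hθ => ?_
    simp only [S, Finset.mem_compl, Finset.mem_filter, Finset.mem_univ, true_and, not_le] at hθ
    exact hθ.le
  have h2 : (S.card : ℝ) + Sᶜ.card = 2 ^ (Fintype.card (α × β)) := by
    have := Finset.card_add_card_compl S
    rw [Fintype.card_fun, Fintype.card_bool] at this
    exact_mod_cast this
  have h3 : (Sᶜ.card : ℝ) * 2 ≤ 2 ^ (Fintype.card (α × β)) := by
    refine le_of_mul_le_mul_right ?_ hM0
    linarith
  linarith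

/-! ### The projection onto the graph of a matrix -/

theorem hsSq_add_add_le {ι κ : Type*} [Fintype ι] [Fintype κ] (A B C : Matrix ι κ ℂ) :
    hsSq (A + B + C) ≤ 3 * (hsSq A + hsSq B + hsSq C) := by
  simp only [hsSq, Finset.mul_sum, ← Finset.sum_add_distrib]
  refine Finset.sum_le_sum fun i _ => Finset.sum_le_sum fun j _ => ?_
  have := norm_add₃_le (a := A i j) (b := B i j) (c := C i j)
  simp only [Matrix.add_apply]
  nlinarith [norm_nonneg (A i j + B i j + C i j), sq_nonneg (‖A i j‖ - ‖B i j‖),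
    sq_nonneg (‖A i j‖ - ‖C i j‖), sq_nonneg (‖B i j‖ - ‖C i j‖)]

section Graph

variable {κ ς : Type*} [Fintype κ] [Fintype ς] [DecidableEq ς]

/-- The inverse of `1 + T* T`. -/
def graphInv (T : Matrix κ ς ℂ) : Matrix ς ς ℂ := (1 + Tᴴ * T)⁻¹

theorem isUnit_det_one_add (T : Matrix κ ς ℂ) : IsUnit (1 + Tᴴ * T).det :=
  (isUnit_iff_isUnit_det _).mp
    (PosDef.one.add_posSemidef (posSemidef_conjTranspose_mul_self T)).isUnit

theorem mul_graphInv (T : Matrix κ ς ℂ) : (1 + Tᴴ * T) * graphInv T = 1 :=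
  mul_nonsing_inv _ (isUnit_det_one_add T)

theorem graphInv_mul (T : Matrix κ ς ℂ) : graphInv T * (1 + Tᴴ * T) = 1 :=
  nonsing_inv_mul _ (isUnit_det_one_add T)

theorem conjTranspose_graphInv (T : Matrix κ ς ℂ) : (graphInv T)ᴴ = graphInv T := by
  rw [graphInv, conjTranspose_nonsing_inv, conjTranspose_add, conjTranspose_one, conjTranspose_mul,
    conjTranspose_conjTranspose]

/-- The matrix of `x ↦ (x, T x)`, whose range is the graph of `T`. -/
def graphMatrix (T : Matrix κ ς ℂ) : Matrix (ς ⊕ κ) ς ℂ := fromRows 1 T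

/-- The orthogonal projection onto the graph `{(x, T x)}` of a matrix `T`. -/
def graphProjection (T : Matrix κ ς ℂ) : Matrix (ς ⊕ κ) (ς ⊕ κ) ℂ :=
  graphMatrix T * graphInv T * (graphMatrix T)ᴴ

theorem conjTranspose_graphMatrix_mul (T : Matrix κ ς ℂ) :
    (graphMatrix T)ᴴ * graphMatrix T = 1 + Tᴴ * T := by
  rw [graphMatrix, conjTranspose_fromRows_eq_fromCols_conjTranspose, fromCols_mul_fromRows, conjTranspose_one,
    one_mul]

theorem isStarProjection_graphProjection (T : Matrix κ ς ℂ) :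
    IsStarProjection (graphProjection T) := by
  refine ⟨?_, ?_⟩
  · calc graphProjection T * graphProjection T
        = graphMatrix T * (graphInv T * ((graphMatrix T)ᴴ * graphMatrix T)) * graphInv T *
            (graphMatrix T)ᴴ := by
          simp only [graphProjection, Matrix.mul_assoc]
      _ = graphProjection T := by
        rw [conjTranspose_graphMatrix_mul, graphInv_mul, Matrix.mul_one, graphProjection]
  · change (graphProjection T)ᴴ = _
    rw [graphProjection, conjTranspose_mul, conjTranspose_mul, conjTranspose_conjTranspose,
      conjTranspose_graphInv, Matrix.mul_assoc]

theorem trace_graphProjection (T : Matrix κ ς ℂ) :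
    (graphProjection T).trace = Fintype.card ς := by
  rw [graphProjection, trace_mul_comm, ← Matrix.mul_assoc, conjTranspose_graphMatrix_mul, mul_graphInv,
    trace_one]

theorem graphProjection_inr_inl (T : Matrix κ ς ℂ) (k : κ) (i : ς) :
    graphProjection T (Sum.inr k) (Sum.inl i) = (T * graphInv T) k i := by
  rw [graphProjection, graphMatrix, conjTranspose_fromRows_eq_fromCols_conjTranspose, fromRows_mul,
    fromRows_mul_fromCols]
  simp

/-- The lower left block `T (1 + T* T)⁻¹` of the projection onto the graph of `T` is close to `T`
as soon as `T* T` is small. -/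
theorem hsSq_sub_mul_graphInv_le (T : Matrix κ ς ℂ) :
    hsSq (T - T * graphInv T) ≤ hsSq (Tᴴ * T) / 4 := by
  set R := graphInv T with hR
  set X := Tᴴ * T with hX
  have hRh : Rᴴ = R := conjTranspose_graphInv T
  have hXh : Xᴴ = X := by rw [hX, conjTranspose_mul, conjTranspose_conjTranspose]
  have hCR : (1 + X) * R = 1 := mul_graphInv T
  have h1 : T - T * R = T * (X * R) := by
    have : T = T * ((1 + X) * R) := by rw [hCR, Matrix.mul_one]
    nth_rw 1 [this]
    rw [add_mul, one_mul, Matrix.mul_add]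
    abel
  have h2 : hsSq (T - T * R) = (R * X * X * X * R).trace.re := by
    rw [h1, hsSq_eq_trace, conjTranspose_mul, conjTranspose_mul, hRh, hXh]
    congr 2
    calc R * X * Tᴴ * (T * (X * R)) = R * X * (Tᴴ * T) * (X * R) := by
          simp only [Matrix.mul_assoc]
      _ = _ := by rw [← hX]; simp only [Matrix.mul_assoc]
  have h3 : hsSq X = (R * (1 + X) * X * X * (1 + X) * R).trace.re := by
    have : X = X * (1 + X) * R := by rw [mul_assoc, hCR, mul_one]
    conv_lhs => rw [this]
    rw [hsSq_eq_trace, conjTranspose_mul, conjTranspose_mul, conjTranspose_add, conjTranspose_one,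
      hRh, hXh]
    congr 2
    simp only [mul_assoc]
  have h4 : hsSq (X * (1 - X) * R) = (R * (1 - X) * X * X * (1 - X) * R).trace.re := by
    rw [hsSq_eq_trace, conjTranspose_mul, conjTranspose_mul, conjTranspose_sub, conjTranspose_one,
      hRh, hXh]
    congr 2
    simp only [mul_assoc]
  -- the noncommutative form of `(1 + x)² = (1 - x)² + 4 x`
  have h5 : R * (1 + X) * X * X * (1 + X) * R =
      R * (1 - X) * X * X * (1 - X) * R + 4 • (R * X * X * X * R) := by noncomm_ring
  have h6 := congrArg (fun A => A.trace.re) h5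
  simp only [trace_add, Complex.add_re, trace_smul, Complex.smul_re] at h6
  rw [← h2, ← h3, ← h4] at h6
  have := hsSq_nonneg (X * (1 - X) * R)
  simp only [nsmul_eq_mul, Nat.cast_ofNat] at h6
  linarith

theorem hsSq_graphProjection_sub_ge (T T' : Matrix κ ς ℂ) :
    hsSq (T - T') / 3 - (hsSq (Tᴴ * T) + hsSq (T'ᴴ * T')) / 4 ≤
      hsSq (graphProjection T - graphProjection T') := by
  have h1 : hsSq (T * graphInv T - T' * graphInv T') ≤
      hsSq (graphProjection T - graphProjection T') := by
    simp only [hsSq, Fintype.sum_sum_type, Matrix.sub_apply, graphProjection_inr_inl,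
      Finset.sum_add_distrib]
    have a1 : (0 : ℝ) ≤ ∑ i : ς, ∑ j : ς, ‖graphProjection T (Sum.inl i) (Sum.inl j) -
        graphProjection T' (Sum.inl i) (Sum.inl j)‖ ^ 2 := by positivity
    have a2 : (0 : ℝ) ≤ ∑ i : ς, ∑ j : κ, ‖graphProjection T (Sum.inl i) (Sum.inr j) -
        graphProjection T' (Sum.inl i) (Sum.inr j)‖ ^ 2 := by positivity
    have a3 : (0 : ℝ) ≤ ∑ i : κ, ∑ j : κ, ‖graphProjection T (Sum.inr i) (Sum.inr j) -
        graphProjection T' (Sum.inr i) (Sum.inr j)‖ ^ 2 := by positivity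
    linarith
  have h2 : T - T' = (T - T * graphInv T) + (T * graphInv T - T' * graphInv T') +
      (T' * graphInv T' - T') := by abel
  have h3 := hsSq_add_add_le (T - T * graphInv T) (T * graphInv T - T' * graphInv T')
    (T' * graphInv T' - T')
  rw [← h2] at h3
  have h4 : hsSq (T' * graphInv T' - T') = hsSq (T' - T' * graphInv T') := by
    simp only [hsSq, Matrix.sub_apply, norm_sub_rev]
  rw [h4] at h3
  have := hsSq_sub_mul_graphInv_le T
  have := hsSq_sub_mul_graphInv_le T'
  linarith

end Graph

/-! ### Packings orthogonal to the reference vector -/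

/-- An isometric embedding of a space of smaller dimension into the orthogonal complement of a unit
vector. -/
theorem exists_isometry_orthogonal {ι κ : Type*} [Fintype ι] [DecidableEq ι] [Fintype κ]
    [DecidableEq κ] {ψ : ι → ℂ} (hψ : star ψ ⬝ᵥ ψ = 1)
    (h : Fintype.card κ + 1 ≤ Fintype.card ι) :
    ∃ V : Matrix ι κ ℂ, Vᴴ * V = 1 ∧ Vᴴ *ᵥ ψ = 0 := by
  obtain ⟨i₀⟩ : Nonempty ι := Fintype.card_pos_iff.mp (by omega)
  obtain ⟨B, hB⟩ := Orthonormal.exists_orthonormalBasis_extension_of_card_eq (𝕜 := ℂ)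
    (E := EuclideanSpace ℂ ι) (ι := ι) (by simp) (v := fun _ => WithLp.toLp 2 ψ) (s := {i₀}) (by
      rw [orthonormal_iff_ite]
      rintro ⟨i, rfl⟩ ⟨j, rfl⟩
      simp only [Set.domRestrict_apply, if_true, EuclideanSpace.inner_toLp_toLp]
      rw [dotProduct_comm, hψ])
  have hB0 : B i₀ = WithLp.toLp 2 ψ := hB i₀ rfl
  have hcard : Fintype.card κ ≤ Fintype.card {i // i ≠ i₀} := by
    rw [Fintype.card_subtype_compl, Fintype.card_subtype_eq]
    omega
  obtain ⟨e⟩ := Function.Embedding.nonempty_of_card_le hcard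
  have hinner : ∀ i j, star (B i : EuclideanSpace ℂ ι).ofLp ⬝ᵥ (B j).ofLp = if i = j then 1 else 0 := by
    intro i j
    rw [← orthonormal_iff_ite.mp B.orthonormal i j, EuclideanSpace.inner_eq_star_dotProduct,
      dotProduct_comm]
  refine ⟨Matrix.of fun i k => (B (e k)).ofLp i, ?_, ?_⟩
  · ext k l
    have := hinner (e k) (e l)
    rw [mul_apply]
    simp only [conjTranspose_apply, of_apply]
    rw [one_apply]
    simp only [dotProduct, Pi.star_apply] at this
    rw [this]
    congr 1
    simp [Subtype.ext_iff.symm]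
  · ext k
    have := hinner (e k) i₀
    rw [if_neg (e k).2, hB0] at this
    exact this

theorem star_mulVec_dotProduct_mulVec {ι κ : Type*} [Fintype ι] [Fintype κ] [DecidableEq κ]
    {V : Matrix ι κ ℂ} (hV : Vᴴ * V = 1) (x y : κ → ℂ) :
    star (V *ᵥ x) ⬝ᵥ (V *ᵥ y) = star x ⬝ᵥ y := by
  rw [star_mulVec, dotProduct_mulVec, vecMul_vecMul, hV, vecMul_one]

theorem card_qubits (b : ℕ) : Fintype.card (Qubits b) = 2 ^ b := by simp

theorem two_pow_le_eight {b : ℕ} (h : ¬ 16 ≤ 2 ^ b) : 2 ^ b ≤ 8 := by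
  have hb4 : b < 4 := by
    by_contra! h'
    exact h (le_trans (by norm_num) (Nat.pow_le_pow_right (n := 2) (by norm_num) h'))
  calc 2 ^ b ≤ 2 ^ 3 := Nat.pow_le_pow_right (by norm_num) (by omega)
    _ = 8 := by norm_num

/-- A separated family of at least `exp (m / 16)` sign patterns of length less than `m = 2 ^ b`. In
small dimension two patterns of length one suffice. -/
theorem exists_short_sign_code {b : ℕ} (hb : 1 ≤ b) :
    ∃ (K : ℕ) (J : Finset (Fin K → Bool)), 1 ≤ K ∧ K + 1 ≤ 2 ^ b ∧
      (2 : ℝ) ^ b / 16 ≤ Real.log J.card ∧ 2 ≤ J.card ∧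
      ∀ θ ∈ J, ∀ η ∈ J, θ ≠ η → K ≤ 8 * hammingDist θ η := by
  have h2 : (2 : ℕ) ^ b = 2 * 2 ^ (b - 1) := by rw [← pow_succ']; congr 1; omega
  by_cases hm : 16 ≤ 2 ^ b
  · obtain ⟨J, -, h1, h3, h4⟩ := exists_sign_code (α := Fin (2 ^ (b - 1)))
      (by rw [Fintype.card_fin]; omega) Finset.univ (by
        rw [Finset.card_univ, Fintype.card_fun, Fintype.card_bool]
        push_cast
        linarith [show (0 : ℝ) ≤ 2 ^ Fintype.card (Fin (2 ^ (b - 1))) by positivity])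
    rw [Fintype.card_fin] at h1 h4
    refine ⟨2 ^ (b - 1), J, Nat.one_le_two_pow, by omega, ?_, h3, h4⟩
    have : (2 : ℝ) ^ b = 2 * ((2 ^ (b - 1) : ℕ) : ℝ) := by exact_mod_cast h2
    rw [this]
    linarith
  · refine ⟨1, Finset.univ, le_rfl, ?_, ?_, ?_, ?_⟩
    · have : 1 ≤ 2 ^ (b - 1) := Nat.one_le_two_pow
      omega
    · have h4 : (2 : ℝ) ^ b ≤ 8 := by exact_mod_cast two_pow_le_eight hm
      rw [Finset.card_univ, Fintype.card_fun, Fintype.card_bool, Fintype.card_fin]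
      norm_num
      linarith [Real.log_two_gt_d9]
    · rw [Finset.card_univ, Fintype.card_fun, Fintype.card_bool, Fintype.card_fin]; norm_num
    · intro θ _ η _ h
      have := hammingDist_pos.mpr h
      omega

/-- An exponentially large separated family of unit vectors orthogonal to the reference vector. -/
theorem exists_vector_packing {b : ℕ} (hb : 1 ≤ b) :
    ∃ (J : Type) (_ : Fintype J) (v : J → Qubits b → ℂ), 2 ≤ Fintype.card J ∧
      (2 : ℝ) ^ b / 16 ≤ Real.log (Fintype.card J) ∧ (∀ j, star (v j) ⬝ᵥ v j = 1) ∧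
      (∀ j, star (v j) ⬝ᵥ refVector b = 0) ∧
      ∀ j k, j ≠ k → 1 / 2 ≤ (star (v j - v k) ⬝ᵥ (v j - v k)).re := by
  obtain ⟨K, J, hK1, hK2, hlog, hJ2, hJ⟩ := exists_short_sign_code hb
  obtain ⟨V, hV, hVψ⟩ := exists_isometry_orthogonal (κ := Fin K) (star_refVector_dotProduct b)
    (by rw [card_qubits, Fintype.card_fin]; exact hK2)
  have hK0 : (0 : ℝ) < K := by exact_mod_cast hK1
  set t : ℝ := (√(K : ℝ))⁻¹ with ht
  have htt : t * t = (K : ℝ)⁻¹ := by rw [ht, ← mul_inv, Real.mul_self_sqrt hK0.le]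
  let x : (Fin K → Bool) → Fin K → ℂ := fun θ k => ((t * boolSign (θ k) : ℝ) : ℂ)
  refine ⟨J, inferInstance, fun θ => V *ᵥ x θ, by simpa using hJ2, by simpa using hlog, ?_, ?_, ?_⟩
  · intro θ
    rw [star_mulVec_dotProduct_mulVec hV]
    have h : ∀ k, star (x θ k) * x θ k = (((K : ℝ)⁻¹ : ℝ) : ℂ) := by
      intro k
      simp only [x, RCLike.star_def, Complex.conj_ofReal]
      rw [← Complex.ofReal_mul, mul_mul_mul_comm, htt, boolSign_mul_self, mul_one]
    simp only [dotProduct, Pi.star_apply, h, Finset.sum_const, Finset.card_univ, Fintype.card_fin,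
      nsmul_eq_mul]
    rw [← Complex.ofReal_natCast, ← Complex.ofReal_mul, mul_inv_cancel₀ hK0.ne', Complex.ofReal_one]
  · intro θ
    rw [star_mulVec, ← dotProduct_mulVec, hVψ, dotProduct_zero]
  · intro θ η hne
    rw [← mulVec_sub, star_mulVec_dotProduct_mulVec hV]
    have h : ∀ k, star ((x θ - x η) k) * (x θ - x η) k =
        (((K : ℝ)⁻¹ * (boolSign (θ.1 k) - boolSign (η.1 k)) ^ 2 : ℝ) : ℂ) := by
      intro k
      simp only [x, Pi.sub_apply, ← Complex.ofReal_sub, RCLike.star_def, Complex.conj_ofReal]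
      rw [← Complex.ofReal_mul, ← htt]
      congr 1
      ring
    simp only [dotProduct, Pi.star_apply, h]
    rw [← Complex.ofReal_sum, Complex.ofReal_re, ← Finset.mul_sum, sum_sq_boolSign_sub]
    have h1 : (K : ℝ) ≤ 8 * hammingDist θ.1 η.1 := by
      exact_mod_cast hJ θ.1 θ.2 η.1 η.2 (fun h => hne (Subtype.ext h))
    rw [inv_mul_eq_div, le_div_iff₀ hK0]
    linarith

theorem isStarProjection_isometry_conj {ι κ : Type*} [Fintype ι] [Fintype κ] [DecidableEq κ]
    {V : Matrix ι κ ℂ} (hV : Vᴴ * V = 1) {P : Matrix κ κ ℂ} (hP : IsStarProjection P) :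
    IsStarProjection (V * P * Vᴴ) := by
  refine ⟨?_, ?_⟩
  · calc V * P * Vᴴ * (V * P * Vᴴ) = V * P * (Vᴴ * V) * P * Vᴴ := by simp only [Matrix.mul_assoc]
      _ = V * (P * P) * Vᴴ := by rw [hV, Matrix.mul_one]; simp only [Matrix.mul_assoc]
      _ = V * P * Vᴴ := by rw [mul_self_of_isStarProjection hP]
  · change (V * P * Vᴴ)ᴴ = _
    rw [conjTranspose_mul, conjTranspose_mul, conjTranspose_conjTranspose,
      (isHermitian_of_isStarProjection hP).eq, Matrix.mul_assoc]

theorem trace_isometry_conj {ι κ : Type*} [Fintype ι] [Fintype κ] [DecidableEq κ]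
    {V : Matrix ι κ ℂ} (hV : Vᴴ * V = 1) (A : Matrix κ κ ℂ) : (V * A * Vᴴ).trace = A.trace := by
  rw [trace_mul_comm, ← Matrix.mul_assoc, hV, Matrix.one_mul]

theorem isometry_conj_mul {ι κ : Type*} [Fintype ι] [Fintype κ] [DecidableEq κ]
    {V : Matrix ι κ ℂ} (hV : Vᴴ * V = 1) (A B : Matrix κ κ ℂ) :
    V * A * Vᴴ * (V * B * Vᴴ) = V * (A * B) * Vᴴ := by
  calc V * A * Vᴴ * (V * B * Vᴴ) = V * A * (Vᴴ * V) * B * Vᴴ := by simp only [Matrix.mul_assoc]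
    _ = _ := by rw [hV, Matrix.mul_one]; simp only [Matrix.mul_assoc]

theorem rank_graphProjection_le {κ ς : Type*} [Fintype κ] [Fintype ς] [DecidableEq ς]
    (T : Matrix κ ς ℂ) : (graphProjection T).rank ≤ Fintype.card ς :=
  (rank_mul_le_left _ _).trans ((rank_mul_le_left _ _).trans (rank_le_card_width _))

theorem trace_mul_eq_of_isStarProjection {ι : Type*} [Fintype ι] {P Q : Matrix ι ι ℂ}
    (hP : IsStarProjection P) (hQ : IsStarProjection Q) :
    2 * (P * Q).trace.re = P.trace.re + Q.trace.re - hsSq (P - Q) := by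
  rw [hsSq_of_isHermitian ((isHermitian_of_isStarProjection hP).sub
    (isHermitian_of_isStarProjection hQ))]
  have : (P - Q) * (P - Q) = P + Q - P * Q - Q * P := by
    rw [sub_mul, mul_sub, mul_sub, mul_self_of_isStarProjection hP,
      mul_self_of_isStarProjection hQ]
    abel
  rw [this, trace_sub, trace_sub, trace_add, trace_mul_comm Q P]
  simp only [Complex.sub_re, Complex.add_re]
  ring

/-- The matrix with entries `± a`. -/
def signMatrix {α β : Type*} (a : ℝ) (θ : α × β → Bool) : Matrix α β ℂ :=
  Matrix.of fun k i => ((a * boolSign (θ (k, i)) : ℝ) : ℂ)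

theorem hsSq_signMatrix_sub {α β : Type*} [Fintype α] [Fintype β] (a : ℝ) (θ η : α × β → Bool) :
    hsSq (signMatrix a θ - signMatrix a η) = a ^ 2 * (4 * hammingDist θ η) := by
  rw [← sum_sq_boolSign_sub, Fintype.sum_prod_type, hsSq, Finset.mul_sum]
  refine Finset.sum_congr rfl fun k _ => ?_
  rw [Finset.mul_sum]
  refine Finset.sum_congr rfl fun i _ => ?_
  rw [Matrix.sub_apply, signMatrix, signMatrix, of_apply, of_apply, ← Complex.ofReal_sub,
    Complex.norm_real, Real.norm_eq_abs, sq_abs]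
  ring

theorem hsSq_conjTranspose_mul_signMatrix {α β : Type*} [Fintype α] [Fintype β] (a : ℝ)
    (θ : α × β → Bool) :
    hsSq ((signMatrix a θ)ᴴ * signMatrix a θ) = a ^ 4 * gramSq θ := by
  rw [gramSq, hsSq, Finset.mul_sum]
  refine Finset.sum_congr rfl fun i _ => ?_
  rw [Finset.mul_sum]
  refine Finset.sum_congr rfl fun j _ => ?_
  have : ((signMatrix a θ)ᴴ * signMatrix a θ) i j =
      ((a ^ 2 * ∑ k, boolSign (θ (k, i)) * boolSign (θ (k, j)) : ℝ) : ℂ) := by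
    rw [mul_apply, Finset.mul_sum, Complex.ofReal_sum]
    refine Finset.sum_congr rfl fun k _ => ?_
    simp only [signMatrix, conjTranspose_apply, of_apply, RCLike.star_def, Complex.conj_ofReal]
    rw [← Complex.ofReal_mul]
    congr 1
    ring
  rw [this, Complex.norm_real, Real.norm_eq_abs, sq_abs]
  ring

/-- A family of `exp (m s / 16)` projections of rank `s`, orthogonal to the reference vector and
separated in the Hilbert–Schmidt norm: the projections onto the graphs of suitably scaled sign
matrices of size `m / 2 × s`. -/
theorem exists_projection_packing {b s : ℕ} (hb : 16 ≤ 2 ^ b) (hs : 1 ≤ s) (hsb : 4 * s ≤ 2 ^ b) :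
    ∃ (J : Type) (_ : Fintype J) (P : J → Matrix (Qubits b) (Qubits b) ℂ), 2 ≤ Fintype.card J ∧
      (2 : ℝ) ^ b * s / 16 ≤ Real.log (Fintype.card J) ∧ (∀ j, IsStarProjection (P j)) ∧
      (∀ j, (P j).trace = s) ∧ (∀ j, (P j).rank ≤ s) ∧ (∀ j, P j *ᵥ refVector b = 0) ∧
      ∀ j k, j ≠ k → (P j * P k).trace.re ≤ s * (1 - 1 / 576) := by
  have hb1 : 1 ≤ b := by
    by_contra! h
    interval_cases b
    norm_num at hb
  have h2 : (2 : ℕ) ^ b = 2 * 2 ^ (b - 1) := by rw [← pow_succ']; congr 1; omega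
  set K : ℕ := 2 ^ (b - 1) with hKdef
  have hK8 : 8 ≤ K := by omega
  have hsK : s ≤ K := by omega
  have hKr : (0 : ℝ) < K := by exact_mod_cast (by omega : 0 < K)
  have hsr : (1 : ℝ) ≤ s := by exact_mod_cast hs
  obtain ⟨J, hJS, hlog, hJ2, hJ⟩ := exists_sign_code (α := Fin K × Fin s)
    (by rw [Fintype.card_prod, Fintype.card_fin, Fintype.card_fin]; nlinarith) _
    (half_le_card_typical (α := Fin K) (β := Fin s) (by simpa using hs) (by simpa using hsK))
  rw [Fintype.card_prod, Fintype.card_fin, Fintype.card_fin] at hlog hJ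
  obtain ⟨V, hV, hVψ⟩ := exists_isometry_orthogonal (κ := Fin s ⊕ Fin K)
    (star_refVector_dotProduct b)
    (by rw [card_qubits, Fintype.card_sum, Fintype.card_fin, Fintype.card_fin]; omega)
  -- with this scaling the separation `s / 48` of the sign matrices beats the error of `s / 144`
  set a : ℝ := √((24 * K)⁻¹) with ha
  have ha2 : a ^ 2 = (24 * K : ℝ)⁻¹ := Real.sq_sqrt (by positivity)
  let p : (Fin K × Fin s → Bool) → Matrix (Fin s ⊕ Fin K) (Fin s ⊕ Fin K) ℂ := fun θ =>
    graphProjection (signMatrix a θ)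
  have hp : ∀ θ, IsStarProjection (p θ) := fun θ => isStarProjection_graphProjection _
  have hptr : ∀ θ, (p θ).trace = s := fun θ => by
    simp only [p]
    rw [trace_graphProjection, Fintype.card_fin]
  refine ⟨J, inferInstance, fun θ => V * p θ * Vᴴ, by simpa using hJ2, ?_,
    fun θ => isStarProjection_isometry_conj hV (hp θ), fun θ => ?_, fun θ => ?_, fun θ => ?_, ?_⟩
  · rw [Fintype.card_coe]
    refine le_trans (le_of_eq ?_) hlog
    have : (2 : ℝ) ^ b = 2 * (K : ℝ) := by exact_mod_cast h2
    rw [this]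
    push_cast
    ring
  · rw [trace_isometry_conj hV, hptr]
  · refine (rank_mul_le_left _ _).trans ((rank_mul_le_right _ _).trans ?_)
    simpa using rank_graphProjection_le (signMatrix a θ.1)
  · rw [← mulVec_mulVec, hVψ, mulVec_zero]
  · intro θ η hne
    rw [isometry_conj_mul hV, trace_isometry_conj hV]
    have h1 := trace_mul_eq_of_isStarProjection (hp θ) (hp η)
    have h3 := hsSq_graphProjection_sub_ge (signMatrix a θ.1) (signMatrix a η.1)
    rw [hptr, hptr] at h1
    simp only [Complex.natCast_re] at h1
    rw [hsSq_signMatrix_sub, hsSq_conjTranspose_mul_signMatrix,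
      hsSq_conjTranspose_mul_signMatrix] at h3
    have hgram : ∀ ζ ∈ J, a ^ 4 * gramSq ζ ≤ s / 144 := by
      intro ζ hζ
      have := (Finset.mem_filter.mp (hJS hζ)).2
      rw [Fintype.card_fin, Fintype.card_fin] at this
      have h4 : a ^ 4 = ((24 * K : ℝ)⁻¹) ^ 2 := by rw [← ha2]; ring
      rw [h4]
      refine (mul_le_mul_of_nonneg_left this (by positivity)).trans (le_of_eq ?_)
      field_simp
      norm_num
    have hham : (s : ℝ) / 48 ≤ a ^ 2 * (4 * hammingDist θ.1 η.1) := by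
      have : ((K * s : ℕ) : ℝ) ≤ 8 * hammingDist θ.1 η.1 := by
        exact_mod_cast hJ θ.1 θ.2 η.1 η.2 (fun h => hne (Subtype.ext h))
      push_cast at this
      rw [ha2, inv_mul_eq_div, le_div_iff₀ (by positivity)]
      linarith
    have h5 := hgram θ.1 θ.2
    have h6 := hgram η.1 η.2
    change (p θ.1 * p η.1).trace.re ≤ _
    change _ ≤ hsSq (p θ.1 - p η.1) at h3
    linarith

/-! ### Pure states and mixtures -/

theorem isStarProjection_vecMulVec {ι : Type*} [Fintype ι] {u : ι → ℂ} (hu : star u ⬝ᵥ u = 1) :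
    IsStarProjection (vecMulVec u (star u)) := by
  refine ⟨?_, ?_⟩
  · change vecMulVec u (star u) * vecMulVec u (star u) = _
    rw [vecMulVec_mul_vecMulVec, hu, one_smul]
  · change (vecMulVec u (star u))ᴴ = _
    rw [conjTranspose_vecMulVec, star_star]

theorem trace_vecMulVec_star {ι : Type*} [Fintype ι] {u : ι → ℂ} (hu : star u ⬝ᵥ u = 1) :
    (vecMulVec u (star u)).trace = 1 := by rw [trace_vecMulVec, dotProduct_comm, hu]

theorem trace_vecMulVec_mul_vecMulVec {ι : Type*} [Fintype ι] (u v : ι → ℂ) :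
    (vecMulVec u (star u) * vecMulVec v (star v)).trace.re = ‖star u ⬝ᵥ v‖ ^ 2 := by
  rw [vecMulVec_mul_vecMulVec, vecMulVec_smul, trace_smul, trace_vecMulVec, dotProduct_comm u,
    star_dotProduct v u, smul_eq_mul, RCLike.star_def, Complex.mul_conj', ← Complex.ofReal_pow,
    Complex.ofReal_re]

/-- The pure state of a unit vector. -/
def pureState {ι : Type*} [Fintype ι] (u : ι → ℂ) (hu : star u ⬝ᵥ u = 1) : DensityMatrix ι :=
  ⟨vecMulVec u (star u), posSemidef_of_isStarProjection (isStarProjection_vecMulVec hu),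
    trace_vecMulVec_star hu⟩

/-- The reference state `ψ ψ*`, where `ψ` is the reference vector. -/
def refState (b : ℕ) : DensityMatrix (Qubits b) :=
  pureState (refVector b) (star_refVector_dotProduct b)

/-- The mixture `(1 - ε) ρ + ε ω` of two states. -/
def mixture {ι : Type*} [Fintype ι] (ρ ω : DensityMatrix ι) (ε : ℝ) (h0 : 0 ≤ ε) (h1 : ε ≤ 1) :
    DensityMatrix ι :=
  ⟨((1 - ε : ℝ) : ℂ) • ρ.1 + (ε : ℂ) • ω.1,
    (ρ.2.1.smul (by exact_mod_cast sub_nonneg.mpr h1)).add (ω.2.1.smul (by exact_mod_cast h0)), by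
      rw [trace_add, trace_smul, trace_smul, ρ.2.2, ω.2.2]
      simp⟩

/-- The maximally mixed state on the range of a projection of rank `s`. -/
def uniformState {ι : Type*} [Fintype ι] (P : Matrix ι ι ℂ) (hP : IsStarProjection P) {s : ℕ}
    (hs : 1 ≤ s) (htr : P.trace = s) : DensityMatrix ι :=
  ⟨(((s : ℝ)⁻¹ : ℝ) : ℂ) • P,
    (posSemidef_of_isStarProjection hP).smul (by exact_mod_cast inv_nonneg.mpr (Nat.cast_nonneg s)),
    by
      have : (s : ℂ) ≠ 0 := by exact_mod_cast (by omega : s ≠ 0)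
      rw [trace_smul, htr]
      simp [this]⟩

theorem mixture_sub_mixture {ι : Type*} [Fintype ι] (ρ ω ω' : DensityMatrix ι) {ε : ℝ}
    (h0 : 0 ≤ ε) (h1 : ε ≤ 1) :
    (mixture ρ ω ε h0 h1).1 - (mixture ρ ω' ε h0 h1).1 = (ε : ℂ) • (ω.1 - ω'.1) := by
  simp only [mixture, smul_sub]
  abel

theorem rank_smul_le {ι : Type*} [Fintype ι] (c : ℂ) (A : Matrix ι ι ℂ) :
    (c • A).rank ≤ A.rank := by
  classical
  have : c • A = (c • 1) * A := by rw [smul_mul_assoc, one_mul]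
  rw [this]
  exact rank_mul_le_right _ _

theorem rank_add_le_rank_add_rank {ι : Type*} [Fintype ι] (A B : Matrix ι ι ℂ) :
    (A + B).rank ≤ A.rank + B.rank := by
  refine (Submodule.finrank_mono ?_).trans
    (Submodule.finrank_add_le_finrank_add_finrank (LinearMap.range A.mulVecLin)
      (LinearMap.range B.mulVecLin))
  rintro _ ⟨x, rfl⟩
  rw [mulVecLin_add]
  exact Submodule.add_mem_sup ⟨x, rfl⟩ ⟨x, rfl⟩

theorem rank_refState_le (b : ℕ) : (refState b).1.rank ≤ 1 := rank_vecMulVec_le _ _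

theorem rank_mixture_le {ι : Type*} [Fintype ι] (ρ ω : DensityMatrix ι) {ε : ℝ}
    (h0 : 0 ≤ ε) (h1 : ε ≤ 1) :
    (mixture ρ ω ε h0 h1).1.rank ≤ ρ.1.rank + ω.1.rank :=
  (rank_add_le_rank_add_rank _ _).trans (add_le_add (rank_smul_le _ _) (rank_smul_le _ _))

theorem minimaxProb_mono {b n r : ℕ}
    {Bad Bad' : DensityMatrix (Qubits b) → DensityMatrix (Qubits b) → Prop}
    (h : ∀ σ ρ, Bad σ ρ → Bad' σ ρ) : minimaxProb b n r Bad ≤ minimaxProb b n r Bad' :=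
  iInf_mono fun _ => iSup₂_mono fun ρ _ => measure_mono fun _ hd => h _ ρ hd

/-! ### Rotations of the reference state -/

/-- The vector `√(1 - δ²) ψ + δ v`. -/
def rotatedVector {ι : Type*} (ψ v : ι → ℂ) (δ : ℝ) : ι → ℂ :=
  ((√(1 - δ ^ 2) : ℝ) : ℂ) • ψ + (δ : ℂ) • v

theorem dotProduct_rotatedVector {ι : Type*} [Fintype ι] (u ψ v : ι → ℂ) (δ : ℝ) :
    u ⬝ᵥ rotatedVector ψ v δ = ((√(1 - δ ^ 2) : ℝ) : ℂ) * (u ⬝ᵥ ψ) + (δ : ℂ) * (u ⬝ᵥ v) := by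
  rw [rotatedVector, dotProduct_add, dotProduct_smul, dotProduct_smul, smul_eq_mul, smul_eq_mul]

theorem star_rotatedVector_dotProduct {ι : Type*} [Fintype ι] {ψ v : ι → ℂ} {δ : ℝ}
    (hδ : δ ^ 2 ≤ 1) (hψ : star ψ ⬝ᵥ ψ = 1) (hv : star v ⬝ᵥ v = 1) (hvψ : star v ⬝ᵥ ψ = 0) :
    star (rotatedVector ψ v δ) ⬝ᵥ rotatedVector ψ v δ = 1 := by
  have hψv : star ψ ⬝ᵥ v = 0 := by rw [star_dotProduct, hvψ, star_zero]
  have h1 : star (rotatedVector ψ v δ) ⬝ᵥ ψ = ((√(1 - δ ^ 2) : ℝ) : ℂ) := by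
    rw [star_dotProduct, dotProduct_rotatedVector, hψ, hψv]
    simp
  have h2 : star (rotatedVector ψ v δ) ⬝ᵥ v = (δ : ℂ) := by
    rw [star_dotProduct, dotProduct_rotatedVector, hv, hvψ]
    simp
  rw [dotProduct_rotatedVector, h1, h2, ← Complex.ofReal_mul, ← Complex.ofReal_mul,
    Real.mul_self_sqrt (by linarith), ← Complex.ofReal_add]
  norm_num
  ring

theorem sq_norm_add_sub_sq_norm_sub (a z : ℂ) :
    ‖a + z‖ ^ 2 - ‖a - z‖ ^ 2 = 4 * (star a * z).re := by
  rw [← Complex.normSq_eq_norm_sq, ← Complex.normSq_eq_norm_sq]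
  simp only [Complex.normSq_apply, Complex.add_re, Complex.add_im, Complex.sub_re, Complex.sub_im,
    Complex.mul_re, RCLike.star_def, Complex.conj_re, Complex.conj_im]
  ring

/-- Two rotations of `ψ` towards `v` and `v'` are separated by the two projections whose difference
is `ψ w* + w ψ*`, where `w` is the direction of `v - v'`. -/
theorem le_schattenDist_pureState_or {ι : Type*} [Fintype ι] [DecidableEq ι] {q : ℝ≥0∞} (hq : 1 ≤ q)
    {ψ v v' : ι → ℂ} {δ : ℝ} (hδ0 : 0 ≤ δ) (hδ : δ ≤ 1 / 2) (hψ : star ψ ⬝ᵥ ψ = 1)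
    (hv : star v ⬝ᵥ ψ = 0) (hv' : star v' ⬝ᵥ ψ = 0)
    (hsep : 1 / 2 ≤ (star (v - v') ⬝ᵥ (v - v')).re)
    (h1 : star (rotatedVector ψ v δ) ⬝ᵥ rotatedVector ψ v δ = 1)
    (h2 : star (rotatedVector ψ v' δ) ⬝ᵥ rotatedVector ψ v' δ = 1) (σ : DensityMatrix ι) :
    δ / 4 ≤ schattenDist q σ (pureState _ h1) ∨ δ / 4 ≤ schattenDist q σ (pureState _ h2) := by
  have hvψ : star ψ ⬝ᵥ v = 0 := by rw [star_dotProduct, hv, star_zero]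
  have hvψ' : star ψ ⬝ᵥ v' = 0 := by rw [star_dotProduct, hv', star_zero]
  set ℓ : ℝ := (star (v - v') ⬝ᵥ (v - v')).re with hℓ
  have hℓc : star (v - v') ⬝ᵥ (v - v') = (ℓ : ℂ) := by
    have := star_dotProduct (v - v') (v - v')
    exact (Complex.conj_eq_iff_re.mp this.symm).symm
  have hℓ0 : 0 < √ℓ := Real.sqrt_pos.mpr (by linarith)
  set w : ι → ℂ := (((√ℓ)⁻¹ : ℝ) : ℂ) • (v - v') with hw
  have hwψ : star w ⬝ᵥ ψ = 0 := by
    rw [hw, star_smul, smul_dotProduct, star_sub, sub_dotProduct, hv, hv', sub_zero, smul_zero]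
  have hψw : star ψ ⬝ᵥ w = 0 := by rw [star_dotProduct, hwψ, star_zero]
  have hww : star w ⬝ᵥ w = 1 := by
    rw [hw, star_smul, smul_dotProduct, dotProduct_smul, hℓc, RCLike.star_def, Complex.conj_ofReal,
      smul_eq_mul, smul_eq_mul, ← Complex.ofReal_mul, ← Complex.ofReal_mul]
    have : (√ℓ)⁻¹ * ((√ℓ)⁻¹ * ℓ) = 1 := by
      nth_rw 3 [← Real.mul_self_sqrt (show 0 ≤ ℓ by linarith)]
      field_simp
    rw [this, Complex.ofReal_one]
  have hwv : (star w ⬝ᵥ v).re - (star w ⬝ᵥ v').re = √ℓ := by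
    rw [← Complex.sub_re, ← dotProduct_sub, hw, star_smul, smul_dotProduct, hℓc, RCLike.star_def,
      Complex.conj_ofReal, smul_eq_mul, ← Complex.ofReal_mul, Complex.ofReal_re]
    nth_rw 2 [← Real.mul_self_sqrt (show 0 ≤ ℓ by linarith)]
    field_simp
  set t : ℝ := (√2)⁻¹ with ht
  have htt : t * t = 1 / 2 := by
    rw [ht, ← mul_inv, Real.mul_self_sqrt (by norm_num)]; norm_num
  have ht0 : 0 ≤ t := by positivity
  have hu : star ((t : ℂ) • (ψ + w)) ⬝ᵥ ((t : ℂ) • (ψ + w)) = 1 := by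
    rw [star_smul, smul_dotProduct, dotProduct_smul, star_add, add_dotProduct, dotProduct_add,
      dotProduct_add, hψ, hww, hwψ, hψw, RCLike.star_def, Complex.conj_ofReal, smul_eq_mul,
      smul_eq_mul, ← mul_assoc, ← Complex.ofReal_mul, htt]
    norm_num
  have hu' : star ((t : ℂ) • (ψ - w)) ⬝ᵥ ((t : ℂ) • (ψ - w)) = 1 := by
    rw [star_smul, smul_dotProduct, dotProduct_smul, star_sub, sub_dotProduct, dotProduct_sub,
      dotProduct_sub, hψ, hww, hwψ, hψw, RCLike.star_def, Complex.conj_ofReal, smul_eq_mul,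
      smul_eq_mul, ← mul_assoc, ← Complex.ofReal_mul, htt]
    norm_num
  have key : ∀ x : ι → ℂ, star ψ ⬝ᵥ x = 0 →
      (vecMulVec (rotatedVector ψ x δ) (star (rotatedVector ψ x δ)) *
        (vecMulVec ((t : ℂ) • (ψ + w)) (star ((t : ℂ) • (ψ + w))) -
          vecMulVec ((t : ℂ) • (ψ - w)) (star ((t : ℂ) • (ψ - w))))).trace.re =
        2 * √(1 - δ ^ 2) * δ * (star w ⬝ᵥ x).re := by
    intro x hx
    have e1 : star ψ ⬝ᵥ rotatedVector ψ x δ = ((√(1 - δ ^ 2) : ℝ) : ℂ) := by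
      rw [dotProduct_rotatedVector, hψ, hx]; simp
    have e2 : star w ⬝ᵥ rotatedVector ψ x δ = (δ : ℂ) * (star w ⬝ᵥ x) := by
      rw [dotProduct_rotatedVector, hwψ]; simp
    rw [mul_sub, trace_sub, Complex.sub_re, trace_mul_comm, trace_vecMulVec_mul_vecMulVec,
      trace_mul_comm, trace_vecMulVec_mul_vecMulVec, star_smul, star_smul, smul_dotProduct,
      smul_dotProduct, star_add, star_sub, add_dotProduct, sub_dotProduct, e1, e2, RCLike.star_def,
      Complex.conj_ofReal, smul_eq_mul, smul_eq_mul, norm_mul, norm_mul, mul_pow, mul_pow,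
      ← mul_sub, sq_norm_add_sub_sq_norm_sub, RCLike.star_def, Complex.conj_ofReal,
      Complex.re_ofReal_mul, Complex.re_ofReal_mul, Complex.norm_real, Real.norm_eq_abs, sq_abs,
      pow_two t, htt]
    ring
  refine le_schattenDist_or hq σ _ _ (isStarProjection_vecMulVec hu)
    (isStarProjection_vecMulVec hu') (R := 2) (by norm_num) (by
      rw [trace_vecMulVec_star hu, trace_vecMulVec_star hu']; norm_num) ?_
  rw [pureState, pureState, sub_mul, trace_sub, Complex.sub_re, key v hvψ, key v' hvψ', ← mul_sub,
    hwv]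
  have hR : (2 : ℝ) ^ (1 - (q⁻¹).toReal) ≤ 2 := by
    conv_rhs => rw [← Real.rpow_one 2]
    exact Real.rpow_le_rpow_of_exponent_le (by norm_num) (by linarith [ENNReal.toReal_nonneg (a := q⁻¹)])
  have hc : 4 / 5 ≤ √(1 - δ ^ 2) := Real.le_sqrt_of_sq_le (by nlinarith)
  have hl : 7 / 10 ≤ √ℓ := Real.le_sqrt_of_sq_le (by norm_num; linarith)
  have h3 : 14 / 25 ≤ √(1 - δ ^ 2) * √ℓ := by
    calc (14 / 25 : ℝ) = 4 / 5 * (7 / 10) := by norm_num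
      _ ≤ _ := mul_le_mul hc hl (by norm_num) (by positivity)
  calc 2 * (δ / 4) * 2 ^ (1 - (q⁻¹).toReal) ≤ 2 * (δ / 4) * 2 :=
        mul_le_mul_of_nonneg_left hR (by positivity)
    _ ≤ 2 * δ * (√(1 - δ ^ 2) * √ℓ) := by nlinarith
    _ = _ := by ring

theorem pauliCoeff_refState_sq_le {b : ℕ} (k : Fin b → Fin 4) (hk : k ≠ 0) :
    pauliCoeff (refState b).1 k ^ 2 ≤ 4 / 9 := pauliCoeff_refProjector_sq_le hk

/-- The parametric rate `min (m / √n) 1` is a lower bound already for pure states. -/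
theorem minimaxProb_pureState {q : ℝ≥0∞} (hq : 1 ≤ q) {b n r : ℕ} (hb : 1 ≤ b) (hn : 1 ≤ n)
    (hr : 1 ≤ r) :
    ENNReal.ofReal (1 / 8) ≤ minimaxProb b n r (fun σ ρ =>
      min (2 ^ b / √(n : ℝ)) 1 / 48 ≤ schattenDist q σ ρ) := by
  obtain ⟨J, _, v, hJ, hlog, hv, hvψ, hsep⟩ := exists_vector_packing hb
  have hn0 : (0 : ℝ) < n := by exact_mod_cast hn
  set d : ℝ := 2 ^ b / √(n : ℝ) with hd
  have hd0 : 0 < d := by positivity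
  set δ : ℝ := min d 1 / 12 with hδ
  have hδ0 : 0 ≤ δ := by positivity
  have hδ1 : δ ≤ 1 / 2 := by linarith [min_le_right d 1]
  have hδd : δ ≤ d / 12 := by linarith [min_le_left d 1]
  have hunit := fun j => star_rotatedVector_dotProduct (δ := δ) (by nlinarith)
    (star_refVector_dotProduct b) (hv j) (hvψ j)
  refine minimaxProb_ge hJ (fun j => pureState _ (hunit j))
    (fun j => (rank_vecMulVec_le _ _).trans hr) (refState b) pauliCoeff_refState_sq_le ?_ ?_
  · intro j
    have h1 := trace_mul_eq_of_isStarProjection (isStarProjection_vecMulVec (hunit j))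
      (isStarProjection_vecMulVec (star_refVector_dotProduct b))
    have h2 : ‖star (rotatedVector (refVector b) (v j) δ) ⬝ᵥ refVector b‖ ^ 2 = 1 - δ ^ 2 := by
      rw [star_dotProduct, norm_star, dotProduct_rotatedVector, star_refVector_dotProduct,
        star_dotProduct, hvψ]
      simp only [star_zero, mul_one, mul_zero, add_zero, Complex.norm_real, Real.norm_eq_abs,
        sq_abs]
      exact Real.sq_sqrt (by nlinarith)
    rw [trace_vecMulVec_mul_vecMulVec, h2, trace_vecMulVec_star (hunit j),
      trace_vecMulVec_star (star_refVector_dotProduct b), hsSq_of_isHermitian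
        ((isHermitian_of_isStarProjection (isStarProjection_vecMulVec (hunit j))).sub
        (isHermitian_of_isStarProjection
          (isStarProjection_vecMulVec (star_refVector_dotProduct b))))] at h1
    have h3 : (((pureState _ (hunit j)).1 - (refState b).1) *
        ((pureState _ (hunit j)).1 - (refState b).1)).trace.re = 2 * δ ^ 2 := by
      rw [Complex.one_re] at h1
      have e : (pureState _ (hunit j)).1 - (refState b).1 =
          vecMulVec (rotatedVector (refVector b) (v j) δ)
            (star (rotatedVector (refVector b) (v j) δ)) -
          vecMulVec (refVector b) (star (refVector b)) := rfl
      rw [e]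
      linarith
    rw [h3]
    have h4 : δ ^ 2 ≤ (d / 12) ^ 2 := pow_le_pow_left₀ hδ0 hδd 2
    have h5 : (d / 12) ^ 2 = (2 ^ b) ^ 2 / n / 144 := by
      rw [hd, div_pow, div_pow, Real.sq_sqrt hn0.le]; norm_num
    calc n * (2 * (2 * δ ^ 2) / 2 ^ b) ≤ n * (2 * (2 * ((2 ^ b) ^ 2 / n / 144)) / 2 ^ b) := by
          rw [h5] at h4
          gcongr
      _ = 2 ^ b / 36 := by field_simp; norm_num
      _ ≤ Real.log (Fintype.card J) / 2 := by
          have : (0 : ℝ) < 2 ^ b := by positivity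
          linarith
  · intro σ j k hjk
    have h48 : min d 1 / 48 = δ / 4 := by rw [hδ]; ring
    rw [h48]
    exact le_schattenDist_pureState_or hq hδ0 hδ1 (star_refVector_dotProduct b) (hvψ j) (hvψ k)
      (hsep j k hjk) (hunit j) (hunit k) σ

/-! ### Mixtures of the reference state with low rank projections -/

/-- The maximally mixed state of `b` qubits. -/
def maximallyMixed (b : ℕ) : DensityMatrix (Qubits b) :=
  uniformState 1 (IsStarProjection.one _) (s := 2 ^ b) Nat.one_le_two_pow (by
    rw [trace_one, card_qubits])

theorem pauliCoeff_maximallyMixed {b : ℕ} {k : Fin b → Fin 4} (hk : k ≠ 0) :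
    pauliCoeff (maximallyMixed b).1 k = 0 := by
  simp [maximallyMixed, uniformState, pauliCoeff, trace_pauliBasis hk]

theorem pauliCoeff_mixture_sq_le {b : ℕ} {ε : ℝ} (h0 : 0 ≤ ε) (h1 : ε ≤ 1) (k : Fin b → Fin 4)
    (hk : k ≠ 0) :
    pauliCoeff (mixture (refState b) (maximallyMixed b) ε h0 h1).1 k ^ 2 ≤ 4 / 9 := by
  rw [mixture, pauliCoeff_add, pauliCoeff_smul, pauliCoeff_smul, pauliCoeff_maximallyMixed hk,
    mul_zero, add_zero, mul_pow]
  have h2 := pauliCoeff_refState_sq_le k hk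
  have h3 : (1 - ε) ^ 2 ≤ 1 := by nlinarith
  calc _ ≤ 1 * pauliCoeff (refState b).1 k ^ 2 := mul_le_mul_of_nonneg_right h3 (sq_nonneg _)
    _ ≤ _ := by linarith

theorem trace_sq_uniformState_sub_le {b s : ℕ} {P : Matrix (Qubits b) (Qubits b) ℂ}
    (hP : IsStarProjection P) (hs : 1 ≤ s) (htr : P.trace = s) :
    (((uniformState P hP hs htr).1 - (maximallyMixed b).1) *
      ((uniformState P hP hs htr).1 - (maximallyMixed b).1)).trace.re ≤ (s : ℝ)⁻¹ := by
  have hs0 : (s : ℝ) ≠ 0 := by exact_mod_cast (by omega : s ≠ 0)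
  have h2 : ((2 : ℝ) ^ b) ≠ 0 := by positivity
  have e : ((uniformState P hP hs htr).1 - (maximallyMixed b).1) *
      ((uniformState P hP hs htr).1 - (maximallyMixed b).1) =
      (((s : ℝ)⁻¹ ^ 2 - 2 * (s : ℝ)⁻¹ * ((2 : ℝ) ^ b)⁻¹ : ℝ) : ℂ) • P +
        ((((2 : ℝ) ^ b)⁻¹ ^ 2 : ℝ) : ℂ) • 1 := by
    simp only [uniformState, maximallyMixed, sub_mul, mul_sub, smul_mul_smul_comm, mul_one, one_mul,
      mul_self_of_isStarProjection hP]
    push_cast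
    module
  rw [e, trace_add, trace_smul, trace_smul, trace_one, card_qubits, htr, smul_eq_mul, smul_eq_mul,
    Complex.add_re, Complex.re_ofReal_mul, Complex.re_ofReal_mul, Complex.natCast_re,
    Complex.natCast_re]
  push_cast
  have : ((s : ℝ)⁻¹ ^ 2 - 2 * (s : ℝ)⁻¹ * ((2 : ℝ) ^ b)⁻¹) * s + ((2 : ℝ) ^ b)⁻¹ ^ 2 * 2 ^ b =
      (s : ℝ)⁻¹ - ((2 : ℝ) ^ b)⁻¹ := by
    field_simp
    ring
  rw [this]
  have : 0 < ((2 : ℝ) ^ b)⁻¹ := by positivity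
  linarith

theorem trace_sq_mixture_sub {ι : Type*} [Fintype ι] (ρ ω ω' : DensityMatrix ι) {ε : ℝ}
    (h0 : 0 ≤ ε) (h1 : ε ≤ 1) :
    (((mixture ρ ω ε h0 h1).1 - (mixture ρ ω' ε h0 h1).1) *
      ((mixture ρ ω ε h0 h1).1 - (mixture ρ ω' ε h0 h1).1)).trace.re =
      ε ^ 2 * ((ω.1 - ω'.1) * (ω.1 - ω'.1)).trace.re := by
  rw [mixture_sub_mixture, smul_mul_smul_comm, trace_smul, smul_eq_mul, ← Complex.ofReal_mul,
    Complex.re_ofReal_mul, pow_two]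

/-- The testing bound for mixtures `(1 - ε) ρ₀ + ε P / s` of the reference state with the normalized
projections of a packing. -/
theorem minimaxProb_mixture {b n r s : ℕ} (hn : 1 ≤ n) (hs : 1 ≤ s) (hsr : s + 1 ≤ r)
    {J : Type} [Fintype J] (hJ : 2 ≤ Fintype.card J)
    (hlog : (2 : ℝ) ^ b * s / 16 ≤ Real.log (Fintype.card J))
    (P : J → Matrix (Qubits b) (Qubits b) ℂ) (hP : ∀ j, IsStarProjection (P j))
    (htr : ∀ j, (P j).trace = s) (hrank : ∀ j, (P j).rank ≤ s) {ε : ℝ} (h0 : 0 ≤ ε) (h1 : ε ≤ 1)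
    (hε : ε ≤ 2 ^ b / √(n : ℝ) * s / 8)
    {Bad : DensityMatrix (Qubits b) → DensityMatrix (Qubits b) → Prop}
    (hBad : ∀ σ j k, j ≠ k →
      Bad σ (mixture (refState b) (uniformState (P j) (hP j) hs (htr j)) ε h0 h1) ∨
      Bad σ (mixture (refState b) (uniformState (P k) (hP k) hs (htr k)) ε h0 h1)) :
    ENNReal.ofReal (1 / 8) ≤ minimaxProb b n r Bad := by
  have hn0 : (0 : ℝ) < n := by exact_mod_cast hn
  have hs0 : (0 : ℝ) < s := by exact_mod_cast hs
  refine minimaxProb_ge hJ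
    (fun j => mixture (refState b) (uniformState (P j) (hP j) hs (htr j)) ε h0 h1)
    (fun j => (rank_mixture_le _ _ h0 h1).trans ?_) _ (pauliCoeff_mixture_sq_le h0 h1) ?_ hBad
  · refine (add_le_add (rank_refState_le b) ((rank_smul_le _ _).trans (hrank j))).trans ?_
    omega
  · intro j
    rw [trace_sq_mixture_sub]
    have h2 := trace_sq_uniformState_sub_le (hP j) hs (htr j)
    have h3 : ε ^ 2 ≤ (2 ^ b / √(n : ℝ) * s / 8) ^ 2 := pow_le_pow_left₀ h0 hε 2
    have h4 : (2 ^ b / √(n : ℝ) * s / 8) ^ 2 = (2 ^ b) ^ 2 / n * s ^ 2 / 64 := by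
      rw [div_pow, mul_pow, div_pow, Real.sq_sqrt hn0.le]; norm_num
    rw [h4] at h3
    have h5 : ε ^ 2 * (((uniformState (P j) (hP j) hs (htr j)).1 - (maximallyMixed b).1) *
        ((uniformState (P j) (hP j) hs (htr j)).1 - (maximallyMixed b).1)).trace.re ≤
        (2 ^ b) ^ 2 / n * s ^ 2 / 64 * (s : ℝ)⁻¹ :=
      (mul_le_mul_of_nonneg_left h2 (sq_nonneg _)).trans
        (mul_le_mul_of_nonneg_right h3 (by positivity))
    calc _ ≤ n * (2 * ((2 ^ b) ^ 2 / n * s ^ 2 / 64 * (s : ℝ)⁻¹) / 2 ^ b) := by gcongr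
      _ = 2 ^ b * s / 32 := by field_simp; norm_num
      _ ≤ _ := by linarith

theorem minimaxProb_schatten_mixture {q : ℝ≥0∞} (hq : 1 ≤ q) {b n r s : ℕ} (hb : 16 ≤ 2 ^ b)
    (hn : 1 ≤ n) (hs : 1 ≤ s) (hsb : 4 * s ≤ 2 ^ b) (hsr : s + 1 ≤ r)
    (hd : 2 ^ b / √(n : ℝ) * s ≤ 1) :
    ENNReal.ofReal (1 / 8) ≤ minimaxProb b n r (fun σ ρ =>
      2 ^ b / √(n : ℝ) * (s : ℝ) ^ (q⁻¹).toReal / 9216 ≤ schattenDist q σ ρ) := by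
  obtain ⟨J, _, P, hJ, hlog, hP, htr, hrank, hPψ, hsep⟩ := exists_projection_packing hb hs hsb
  have hn0 : (0 : ℝ) < n := by exact_mod_cast hn
  have hs0 : (0 : ℝ) < s := by exact_mod_cast hs
  set d : ℝ := 2 ^ b / √(n : ℝ) with hd'
  have hd0 : 0 < d := by positivity
  refine minimaxProb_mixture hn hs hsr hJ hlog P hP htr hrank (ε := d * s / 8) (by positivity)
    (by linarith) le_rfl fun σ j k hjk => ?_
  refine le_schattenDist_or hq σ _ _ (hP j) (hP k) (R := 2 * s) (by positivity) (by
    rw [htr, htr, Complex.natCast_re]; linarith) ?_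
  have h1 := trace_mul_eq_of_isStarProjection (hP j) (hP k)
  have h2 := hsep j k hjk
  rw [htr, htr, Complex.natCast_re] at h1
  rw [mixture_sub_mixture, uniformState, uniformState, ← smul_sub, smul_mul_assoc, smul_mul_assoc,
    smul_smul, ← Complex.ofReal_mul, trace_smul, smul_eq_mul, Complex.re_ofReal_mul,
    ← hsSq_of_isHermitian ((isHermitian_of_isStarProjection (hP j)).sub
      (isHermitian_of_isStarProjection (hP k)))]
  have h3 : (s : ℝ) / 288 ≤ hsSq (P j - P k) := by linarith
  have e1 : d * s / 8 * (s : ℝ)⁻¹ = d / 8 := by field_simp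
  rw [e1]
  set x : ℝ := (q⁻¹).toReal with hx
  have hR : (2 * s : ℝ) ^ (1 - x) ≤ 2 * (s : ℝ) ^ (1 - x) := by
    rw [Real.mul_rpow (by norm_num) hs0.le]
    refine mul_le_mul_of_nonneg_right ?_ (by positivity)
    conv_rhs => rw [← Real.rpow_one 2]
    exact Real.rpow_le_rpow_of_exponent_le (by norm_num)
      (by linarith [ENNReal.toReal_nonneg (a := q⁻¹)])
  have e2 : (s : ℝ) ^ x * (s : ℝ) ^ (1 - x) = s := by
    rw [← Real.rpow_add hs0]; simp
  calc 2 * (d * (s : ℝ) ^ x / 9216) * (2 * s : ℝ) ^ (1 - x)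
      ≤ 2 * (d * (s : ℝ) ^ x / 9216) * (2 * (s : ℝ) ^ (1 - x)) :=
        mul_le_mul_of_nonneg_left hR (by positivity)
    _ = d / 2304 * ((s : ℝ) ^ x * (s : ℝ) ^ (1 - x)) := by ring
    _ = d / 8 * (s / 288) := by rw [e2]; ring
    _ ≤ d / 8 * hsSq (P j - P k) := mul_le_mul_of_nonneg_left h3 (by positivity)

/-- Some two-valued measurement, that of a projection `P`, distinguishes `σ` and `ρ`: the square
roots of the probabilities of its outcome `1` have squared difference at least `t`, which bounds
their squared Hellinger distance below. -/
def MeasurementSeparated {ι : Type*} [Fintype ι] (t : ℝ) (σ ρ : DensityMatrix ι) : Prop :=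
  ∃ P : Matrix ι ι ℂ, IsStarProjection P ∧
    t ≤ (√(σ.1 * P).trace.re - √(ρ.1 * P).trace.re) ^ 2

theorem measurementSeparated_or {ι : Type*} [Fintype ι] (σ ρ τ : DensityMatrix ι)
    {P : Matrix ι ι ℂ} (hP : IsStarProjection P) {t : ℝ} (ht : 0 ≤ t)
    (h : 2 * t ≤ |√(ρ.1 * P).trace.re - √(τ.1 * P).trace.re|) :
    MeasurementSeparated (t ^ 2) σ ρ ∨ MeasurementSeparated (t ^ 2) σ τ := by
  rcases sq_le_sq_sqrt_sub_or (z := √(σ.1 * P).trace.re) ht h with h | h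
  · exact Or.inl ⟨P, hP, by rw [sub_sq_comm]; exact h⟩
  · exact Or.inr ⟨P, hP, by rw [sub_sq_comm]; exact h⟩

theorem trace_mixture_mul {ι : Type*} [Fintype ι] (ρ ω : DensityMatrix ι) {ε : ℝ}
    (h0 : 0 ≤ ε) (h1 : ε ≤ 1) {P : Matrix ι ι ℂ} (h : ρ.1 * P = 0) :
    ((mixture ρ ω ε h0 h1).1 * P).trace.re = ε * (ω.1 * P).trace.re := by
  rw [mixture, add_mul, smul_mul_assoc, smul_mul_assoc, h, smul_zero, zero_add, trace_smul,
    smul_eq_mul, Complex.re_ofReal_mul]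

theorem refState_mul_eq_zero {b : ℕ} {P : Matrix (Qubits b) (Qubits b) ℂ} (hP : IsStarProjection P)
    (h : P *ᵥ refVector b = 0) : (refState b).1 * P = 0 := by
  change vecMulVec _ _ * P = 0
  rw [vecMulVec_mul]
  have : star (refVector b) ᵥ* P = 0 := by
    have h1 := star_mulVec P (refVector b)
    rw [h, star_zero, (isHermitian_of_isStarProjection hP).eq] at h1
    exact h1.symm
  rw [this, vecMulVec_zero]

theorem minimaxProb_separated_mixture {b n r s : ℕ} (hb : 16 ≤ 2 ^ b)
    (hn : 1 ≤ n) (hs : 1 ≤ s) (hsb : 4 * s ≤ 2 ^ b) (hsr : s + 1 ≤ r) :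
    ENNReal.ofReal (1 / 8) ≤ minimaxProb b n r
      (MeasurementSeparated (min (2 ^ b / √(n : ℝ) * s / 8) 1 / 2304 ^ 2)) := by
  obtain ⟨J, _, P, hJ, hlog, hP, htr, hrank, hPψ, hsep⟩ := exists_projection_packing hb hs hsb
  have hn0 : (0 : ℝ) < n := by exact_mod_cast hn
  have hs0 : (0 : ℝ) < s := by exact_mod_cast hs
  set ε : ℝ := min (2 ^ b / √(n : ℝ) * s / 8) 1 with hε
  have hε0 : 0 ≤ ε := by positivity
  refine minimaxProb_mixture hn hs hsr hJ hlog P hP htr hrank (ε := ε) hε0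
    (min_le_right _ _) (min_le_left _ _) fun σ j k hjk => ?_
  have e : ε / 2304 ^ 2 = (√ε / 2304) ^ 2 := by rw [div_pow, Real.sq_sqrt hε0]
  rw [e]
  refine measurementSeparated_or σ _ _ (hP j) (by positivity) ?_
  have href := refState_mul_eq_zero (hP j) (hPψ j)
  rw [trace_mixture_mul _ _ hε0 (min_le_right _ _) href,
    trace_mixture_mul _ _ hε0 (min_le_right _ _) href, uniformState, uniformState, smul_mul_assoc,
    smul_mul_assoc, trace_smul, trace_smul, smul_eq_mul, smul_eq_mul, Complex.re_ofReal_mul,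
    Complex.re_ofReal_mul, mul_self_of_isStarProjection (hP j), htr, Complex.natCast_re,
    inv_mul_cancel₀ hs0.ne', mul_one]
  have h1 : ε * ((s : ℝ)⁻¹ * (P k * P j).trace.re) ≤ ε * (1 - 1 / 1152) ^ 2 := by
    refine mul_le_mul_of_nonneg_left ?_ hε0
    rw [inv_mul_le_iff₀ hs0]
    refine (hsep k j hjk.symm).trans (mul_le_mul_of_nonneg_left (by norm_num) hs0.le)
  have h2 := Real.sqrt_le_sqrt h1
  rw [Real.sqrt_mul hε0 ((1 - 1 / 1152) ^ 2), Real.sqrt_sq (by norm_num)] at h2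
  refine le_trans ?_ (le_abs_self _)
  linarith

/-- In small dimension it suffices to distinguish the reference state from one mixture. -/
theorem minimaxProb_separated_two_point {b n r : ℕ} (hb : 1 ≤ b) (hn : 1 ≤ n) (hr : 2 ≤ r) :
    ENNReal.ofReal (1 / 8) ≤ minimaxProb b n r
      (MeasurementSeparated (1 / (12 * √(n : ℝ)))) := by
  obtain ⟨J, _, v, hJ, -, hv, hvψ, -⟩ := exists_vector_packing hb
  obtain ⟨j⟩ : Nonempty J := Fintype.card_pos_iff.mp (by omega)
  have hn1 : (1 : ℝ) ≤ n := by exact_mod_cast hn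
  have hsn : 1 ≤ √(n : ℝ) := Real.one_le_sqrt.mpr hn1
  set ε : ℝ := 1 / (3 * √(n : ℝ)) with hε
  have hε0 : 0 ≤ ε := by positivity
  have hε1 : ε ≤ 1 := by
    rw [hε, div_le_one (by positivity)]; linarith
  set ω : DensityMatrix (Qubits b) := pureState (v j) (hv j)
  have hω : IsStarProjection ω.1 := isStarProjection_vecMulVec (hv j)
  have href : (refState b).1 * ω.1 = 0 := by
    refine refState_mul_eq_zero hω ?_
    change vecMulVec (v j) (star (v j)) *ᵥ _ = 0
    rw [vecMulVec_mulVec, hvψ]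
    simp
  have hmix : ((mixture (refState b) ω ε hε0 hε1).1 - (refState b).1) =
      (ε : ℂ) • (ω.1 - (refState b).1) := by
    simp only [mixture]
    push_cast
    module
  let ρ : Bool → DensityMatrix (Qubits b) := fun x =>
    if x then mixture (refState b) ω ε hε0 hε1 else refState b
  refine minimaxProb_ge (J := Bool) (by simp) ρ ?_ (refState b) pauliCoeff_refState_sq_le ?_ ?_
  · intro x
    have h1 : (refState b).1.rank ≤ 1 := rank_refState_le b
    have h2 : ω.1.rank ≤ 1 := rank_vecMulVec_le _ _
    cases x
    · exact h1.trans (by omega)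
    · refine (rank_mixture_le _ _ hε0 hε1).trans ?_
      omega
  · intro x
    have hlog : (0.69 : ℝ) ≤ Real.log (Fintype.card Bool) := by
      rw [Fintype.card_bool]
      push_cast
      linarith [Real.log_two_gt_d9]
    cases x
    · simp only [ρ, Bool.false_eq_true, if_false, sub_self, mul_zero, trace_zero, Complex.zero_re,
        zero_div]
      linarith
    · simp only [ρ, if_true]
      have h1 := trace_mul_eq_of_isStarProjection hω
        (isStarProjection_vecMulVec (star_refVector_dotProduct b))
      have h2 : (ω.1 * vecMulVec (refVector b) (star (refVector b))).trace = 0 := by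
        rw [trace_mul_comm]
        have := congrArg trace href
        rwa [trace_zero] at this
      rw [h2, ω.2.2, trace_vecMulVec_star (star_refVector_dotProduct b), hsSq_of_isHermitian
        ((isHermitian_of_isStarProjection hω).sub (isHermitian_of_isStarProjection
          (isStarProjection_vecMulVec (star_refVector_dotProduct b))))] at h1
      have h3 : ((ω.1 - (refState b).1) * (ω.1 - (refState b).1)).trace.re = 2 := by
        simp only [Complex.zero_re, Complex.one_re, mul_zero] at h1
        have e : (refState b).1 = vecMulVec (refVector b) (star (refVector b)) := rfl
        rw [e]
        linarith
      rw [hmix, smul_mul_smul_comm, trace_smul, smul_eq_mul, ← Complex.ofReal_mul,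
        Complex.re_ofReal_mul, h3]
      have h4 : ε * ε = 1 / (9 * n) := by
        rw [hε, div_mul_div_comm, mul_mul_mul_comm, Real.mul_self_sqrt (by linarith)]; norm_num
      have h5 : (2 : ℝ) ≤ 2 ^ b := by
        calc (2 : ℝ) = 2 ^ 1 := by norm_num
          _ ≤ 2 ^ b := pow_le_pow_right₀ (by norm_num) hb
      rw [h4]
      calc (n : ℝ) * (2 * (1 / (9 * n) * 2) / 2 ^ b) = 4 / 9 / 2 ^ b := by field_simp; norm_num
        _ ≤ 4 / 9 / 2 := div_le_div_of_nonneg_left (by norm_num) (by norm_num) h5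
        _ ≤ _ := by linarith
  · intro σ
    have key : MeasurementSeparated ((√ε / 2) ^ 2) σ (mixture (refState b) ω ε hε0 hε1) ∨
        MeasurementSeparated ((√ε / 2) ^ 2) σ (refState b) := by
      refine measurementSeparated_or σ _ _ hω (by positivity) ?_
      rw [trace_mixture_mul _ _ hε0 hε1 href, href, mul_self_of_isStarProjection hω, ω.2.2]
      simp only [trace_zero, Complex.zero_re, Real.sqrt_zero, Complex.one_re, mul_one, sub_zero]
      rw [abs_of_nonneg (Real.sqrt_nonneg _)]
      linarith
    have e : (√ε / 2) ^ 2 = 1 / (12 * √(n : ℝ)) := by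
      rw [div_pow, Real.sq_sqrt hε0, hε]; field_simp; norm_num
    rw [e] at key
    intro x y hxy
    cases x <;> cases y
    · exact absurd rfl hxy
    · exact key.symm
    · exact key
    · exact absurd rfl hxy

/-! ### The minimax rates -/

theorem two_pow_eq_four_mul {b : ℕ} (h : 16 ≤ 2 ^ b) : ∃ k, 2 ^ b = 4 * k := by
  have hb : 2 ≤ b := by
    by_contra! h'
    interval_cases b <;> norm_num at h
  exact ⟨2 ^ (b - 2), by rw [show (4 : ℕ) = 2 ^ 2 by norm_num, ← pow_add]; congr 1; omega⟩

theorem rpow_le_self_of_one_le {x y : ℝ} (hx : 1 ≤ x) (hy : y ≤ 1) : x ^ y ≤ x := by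
  conv_rhs => rw [← Real.rpow_one x]
  exact Real.rpow_le_rpow_of_exponent_le hx hy

/-- The lower bound in Schatten norms, with a numerical constant. -/
theorem minimaxProb_schatten {q : ℝ≥0∞} (hq : 1 ≤ q) {b n r : ℕ} (hb : 1 ≤ b) (hn : 1 ≤ n)
    (hr : 1 ≤ r) (hrb : r ≤ 2 ^ b) :
    ENNReal.ofReal (1 / 8) ≤ minimaxProb b n r (fun σ ρ =>
      1 / 10 ^ 9 * min (min (2 ^ b * (r : ℝ) ^ (q⁻¹).toReal / √(n : ℝ))
        ((2 ^ b / √(n : ℝ)) ^ (1 - (q⁻¹).toReal))) 1 ≤ schattenDist q σ ρ) := by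
  have hn0 : (0 : ℝ) < n := by exact_mod_cast hn
  have hr1 : (1 : ℝ) ≤ r := by exact_mod_cast hr
  set x : ℝ := (q⁻¹).toReal with hx
  have hx0 : 0 ≤ x := ENNReal.toReal_nonneg
  have hx1 : x ≤ 1 := by
    rw [hx, ← ENNReal.toReal_one]
    exact ENNReal.toReal_mono (by simp) (ENNReal.inv_le_one.mpr hq)
  have e : 2 ^ b * (r : ℝ) ^ x / √(n : ℝ) = 2 ^ b / √(n : ℝ) * (r : ℝ) ^ x := by ring
  rw [e]
  set d : ℝ := 2 ^ b / √(n : ℝ) with hd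
  have hd0 : 0 < d := by positivity
  have hrx : 0 ≤ (r : ℝ) ^ x := by positivity
  have hdx : 0 ≤ d ^ (1 - x) := by positivity
  -- in these cases the rate is at most `8 * min d 1`, which pure states achieve
  have hpure : min (min (d * (r : ℝ) ^ x) (d ^ (1 - x))) 1 ≤ 8 * min d 1 →
      ENNReal.ofReal (1 / 8) ≤ minimaxProb b n r (fun σ ρ =>
        1 / 10 ^ 9 * min (min (d * (r : ℝ) ^ x) (d ^ (1 - x))) 1 ≤ schattenDist q σ ρ) := by
    intro h
    refine (minimaxProb_pureState hq hb hn hr).trans (minimaxProb_mono fun σ ρ h' => ?_)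
    refine le_trans ?_ h'
    have : 0 ≤ min d 1 := by positivity
    linarith
  by_cases hd1 : 1 ≤ d
  · refine hpure ((min_le_right _ _).trans ?_)
    rw [min_eq_right hd1]
    norm_num
  push Not at hd1
  have hmd : min d 1 = d := min_eq_left hd1.le
  have hsmall : r ≤ 8 → min (min (d * (r : ℝ) ^ x) (d ^ (1 - x))) 1 ≤ 8 * min d 1 := by
    intro h8
    have h8' : (r : ℝ) ≤ 8 := by exact_mod_cast h8
    rw [hmd]
    refine (min_le_left _ _).trans ((min_le_left _ _).trans ?_)
    rw [mul_comm]
    exact mul_le_mul_of_nonneg_right ((rpow_le_self_of_one_le hr1 hx1).trans h8') hd0.le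
  by_cases hm : 16 ≤ 2 ^ b
  swap
  · exact hpure (hsmall (hrb.trans (two_pow_le_eight hm)))
  by_cases hr2 : 2 ≤ r
  swap
  · exact hpure (hsmall (by omega))
  obtain ⟨k, hk⟩ := two_pow_eq_four_mul hm
  have hinv : 1 ≤ 1 / d := by rw [le_div_iff₀ hd0]; linarith
  have hfl1 : 1 ≤ ⌊1 / d⌋₊ := Nat.one_le_floor_iff _ |>.mpr hinv
  have hfl : 1 / d < ⌊1 / d⌋₊ + 1 := Nat.lt_floor_add_one _
  have hfl' : (⌊1 / d⌋₊ : ℝ) ≤ 1 / d := Nat.floor_le (by positivity)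
  have hfl1' : (1 : ℝ) ≤ ⌊1 / d⌋₊ := by exact_mod_cast hfl1
  -- of the order of `min r (1 / d)`: the rank is reduced so that the weight `d s / 8` of the
  -- projection in the mixture stays below `1`
  set s : ℕ := min ((r + 3) / 4) ⌊1 / d⌋₊ with hs
  have hs1 : 1 ≤ s := le_min (by omega) hfl1
  have hsle : s ≤ (r + 3) / 4 := min_le_left _ _
  have hsd : d * s ≤ 1 := by
    have : (s : ℝ) ≤ 1 / d := le_trans (by exact_mod_cast min_le_right _ _) hfl'
    calc d * s ≤ d * (1 / d) := mul_le_mul_of_nonneg_left this hd0.le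
      _ = 1 := by field_simp
  refine (minimaxProb_schatten_mixture hq (s := s) hm hn hs1 (by omega) (by omega) hsd).trans
    (minimaxProb_mono fun σ ρ h' => ?_)
  refine le_trans ?_ h'
  rw [← hd, ← hx]
  have hkey : min (d * (r : ℝ) ^ x) (d ^ (1 - x)) ≤ 4 * (d * (s : ℝ) ^ x) := by
    rcases min_choice ((r + 3) / 4) ⌊1 / d⌋₊ with h | h
    · refine (min_le_left _ _).trans ?_
      have h1 : (r : ℝ) ≤ 4 * s := by
        have : r ≤ 4 * s := by omega
        exact_mod_cast this
      have h2 : (r : ℝ) ^ x ≤ 4 * (s : ℝ) ^ x := by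
        refine (Real.rpow_le_rpow (by positivity) h1 hx0).trans ?_
        rw [Real.mul_rpow (by norm_num) (by positivity)]
        exact mul_le_mul_of_nonneg_right (rpow_le_self_of_one_le (by norm_num) hx1) (by positivity)
      nlinarith
    · refine (min_le_right _ _).trans ?_
      rw [← hs] at h
      have h1 : 1 / d ≤ 4 * s := by rw [h]; linarith
      have h2 : (1 / d) ^ x ≤ 4 * (s : ℝ) ^ x := by
        refine (Real.rpow_le_rpow (by positivity) h1 hx0).trans ?_
        rw [Real.mul_rpow (by norm_num) (by positivity)]
        exact mul_le_mul_of_nonneg_right (rpow_le_self_of_one_le (by norm_num) hx1) (by positivity)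
      have h3 : d ^ (1 - x) = d * (1 / d) ^ x := by
        rw [Real.rpow_sub hd0, Real.rpow_one, one_div, Real.inv_rpow hd0.le]
        rfl
      rw [h3]
      nlinarith
  have h5 := min_le_left (min (d * (r : ℝ) ^ x) (d ^ (1 - x))) 1
  have h6 : 0 ≤ d * (s : ℝ) ^ x := by positivity
  linarith

/-- Every estimator is, with constant probability, told apart from the true state by a two-valued
measurement, up to a squared Hellinger distance of the order of the rate `min (m r / √n) 1`. -/
theorem minimaxProb_separated {b n r : ℕ} (hb : 1 ≤ b) (hn : 1 ≤ n) (hr : 2 ≤ r)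
    (hrb : r ≤ 2 ^ b) :
    ENNReal.ofReal (1 / 8) ≤ minimaxProb b n r
      (MeasurementSeparated (1 / 10 ^ 9 * min (2 ^ b * r / √(n : ℝ)) 1)) := by
  have hn0 : (0 : ℝ) < n := by exact_mod_cast hn
  by_cases hm : 16 ≤ 2 ^ b
  · obtain ⟨k, hk⟩ := two_pow_eq_four_mul hm
    refine (minimaxProb_separated_mixture (s := (r + 3) / 4) hm hn (by omega) (by omega)
      (by omega)).trans (minimaxProb_mono fun σ ρ => ?_)
    rintro ⟨P, hP, h⟩
    refine ⟨P, hP, le_trans ?_ h⟩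
    have h1 : (r : ℝ) ≤ 4 * ((r + 3) / 4 : ℕ) := by
      have : r ≤ 4 * ((r + 3) / 4) := by omega
      exact_mod_cast this
    set s : ℝ := (((r + 3) / 4 : ℕ) : ℝ)
    have hd0 : (0 : ℝ) < 2 ^ b / √(n : ℝ) := by positivity
    have h2 : min (2 ^ b * r / √(n : ℝ)) 1 ≤ 32 * min (2 ^ b / √(n : ℝ) * s / 8) 1 := by
      rw [mul_div_right_comm]
      rcases min_choice (2 ^ b / √(n : ℝ) * s / 8) 1 with h | h
      · rw [h]
        refine (min_le_left _ _).trans ?_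
        nlinarith
      · rw [h]
        exact (min_le_right _ _).trans (by norm_num)
    have h3 : 0 ≤ min (2 ^ b / √(n : ℝ) * s / 8) 1 := by positivity
    linarith
  · refine (minimaxProb_separated_two_point hb hn hr).trans (minimaxProb_mono fun σ ρ => ?_)
    rintro ⟨P, hP, h⟩
    refine ⟨P, hP, le_trans ?_ h⟩
    have h8 := two_pow_le_eight hm
    have h1 : (2 : ℝ) ^ b ≤ 8 := by exact_mod_cast h8
    have h2 : (r : ℝ) ≤ 8 := by exact_mod_cast hrb.trans h8
    have h3 : (2 : ℝ) ^ b * r ≤ 64 := by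
      calc (2 : ℝ) ^ b * r ≤ 8 * 8 := mul_le_mul h1 h2 (by positivity) (by norm_num)
        _ = 64 := by norm_num
    have h4 : 2 ^ b * r / √(n : ℝ) ≤ 64 / √(n : ℝ) := div_le_div_of_nonneg_right h3 (by positivity)
    have h5 : 1 / (12 * √(n : ℝ)) = 64 / √(n : ℝ) / 768 := by field_simp; norm_num
    rw [h5]
    have h6 := min_le_left (2 ^ b * r / √(n : ℝ)) 1
    have h7 : 0 ≤ 64 / √(n : ℝ) := by positivity
    linarith

end QuantumTomography

end

theorem mainTheorem4 (q : ℝ≥0∞) (hq : 1 ≤ q) :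
    ∃ c c' : ℝ, 0 < c ∧ 0 < c' ∧
      ∀ b n r : ℕ, 1 ≤ b → 1 ≤ n → 1 ≤ r → r ≤ 2 ^ b →
        ∀ m : ℝ, m = 2 ^ b →
          ENNReal.ofReal c' ≤ QuantumTomography.minimaxProb b n r (fun ρhat ρ =>
            c * min (min (m * (r : ℝ) ^ (q⁻¹).toReal / √(n : ℝ))
                ((m / √(n : ℝ)) ^ (1 - (q⁻¹).toReal))) 1
              ≤ QuantumTomography.schattenDist q ρhat ρ) ∧
          (2 ≤ r →
            ENNReal.ofReal c' ≤ QuantumTomography.minimaxProb b n r (fun ρhat ρ =>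
              c * min (m * r / √(n : ℝ)) 1 ≤ QuantumTomography.buresSq ρhat ρ) ∧
            ENNReal.ofReal c' ≤ QuantumTomography.minimaxProb b n r (fun ρhat ρ =>
              ((c * min (m * r / √(n : ℝ)) 1 : ℝ) : EReal)
                ≤ QuantumTomography.klDivergence ρ ρhat)) := by
  refine ⟨1 / 10 ^ 9, 1 / 8, by norm_num, by norm_num, ?_⟩
  rintro b n r hb hn hr hrb m rfl
  refine ⟨QuantumTomography.minimaxProb_schatten hq hb hn hr hrb, fun hr2 => ?_⟩
  have h := QuantumTomography.minimaxProb_separated hb hn hr2 hrb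
  refine ⟨h.trans (QuantumTomography.minimaxProb_mono ?_),
    h.trans (QuantumTomography.minimaxProb_mono ?_)⟩
  · rintro σ ρ ⟨P, hP, hle⟩
    exact hle.trans (QuantumTomography.sq_sqrt_sub_sqrt_le_buresSq σ ρ hP)
  · rintro σ ρ ⟨P, hP, hle⟩
    refine le_trans ?_ (QuantumTomography.sq_sqrt_sub_sqrt_le_klDivergence ρ σ hP)
    rw [sub_sq_comm]
    exact EReal.coe_le_coe_iff.mpr hle
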